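/- Let $k$ be a field of characteristic zero, let $R$ be a commutative affine $k$-algebra (that is, a finitely generated commutative $k$-algebra that is an integral domain), and let $\delta$ be a $k$-linear derivation of $R$. Let $R[x;\delta]$ be the skew polynomial ring: it is free as a left $R$-module with basis $\{x^n : n\ge 0\}$, and $xr=rx+\delta(r)$ for all $r\in R$. A prime $\delta$-ideal of $R$ is a prime ideal $P$ with $\delta(P)\subseteq P$. Such a $P$ is called (a) $\delta$-primitive if there is a maximal ideal $\mathfrak m$ of $R$ such that $P$ is maximal among the prime $\delta$-ideals contained in $\mathfrak m$; (b) $\delta$-locally closed if the intersection of all prime $\delta$-ideals of $R$ that properly contain $P$ is strictly larger than $P$; (c) $\delta$-rational if every element of $\operatorname{Frac}(R/P)$ that is a constant for the derivation induced by $\delta$ is algebraic over $k$. The $\delta$-DME holds for $(R,\delta)$ if (a), (b) and (c) are equivalent for every prime $\delta$-ideal $P$ of $R$. Let $A$ be a noetherian associative $k$-algebra. A (two-sided) prime ideal $P$ of $A$ is called (i) primitive if it is the annihilator of a simple left $A$-module; (ii) locally closed if the intersection of all prime ideals of $A$ that properly contain $P$ is strictly larger than $P$; (iii) rational if the centre of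 the Goldie quotient ring $\operatorname{Frac}(A/P)$ is an algebraic field extension of $k$. The DME holds for $A$ if (i), (ii) and (iii) are equivalent for every prime ideal $P$ of $A$. (In (b) and (ii) an empty intersection is the whole ring.) Proposition. If every $\delta$-rational prime $\delta$-ideal of $R$ is $\delta$-locally closed, then every rational prime ideal of $R[x;\delta]$ is locally closed. In particular, if the $\delta$-DME holds for $(R,\delta)$, then the DME holds for $R[x;\delta]$. -/

import Mathlib

open scoped nonZeroDivisors

universe u v

/-! ### Skew polynomial rings `R[x;δ]` -/

section SkewPolynomialRing

variable {k : Type u} {R : Type v} [CommRing k] [CommRing R] [Algebra k R]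

/-- The skew polynomial ring `R[x;δ]`. Its elements are the formal left polynomials `∑ aᵢ xⁱ` with
coefficients `aᵢ` in `R`, so its additive group is the one of `Polynomial R`; the product is the
one with `x * r = r * x + δ r`, see `SkewPoly.X_mul_C` and `SkewPoly.toPoly_C_mul_X_pow`. -/
def SkewPoly (_δ : Derivation k R R) : Type v := Polynomial R

namespace SkewPoly

noncomputable instance (δ : Derivation k R R) : AddCommGroup (SkewPoly δ) :=
  inferInstanceAs (AddCommGroup (Polynomial R))

/-- The sequence of left coefficients of an element of `R[x;δ]`, as an ordinary polynomial. -/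
noncomputable def toPoly (δ : Derivation k R R) : SkewPoly δ ≃+ Polynomial R := AddEquiv.refl _

/-- Left multiplication by `x` on left polynomials:
`x * ∑ bⱼ xʲ = ∑ bⱼ xʲ⁺¹ + ∑ δ(bⱼ) xʲ`. -/
noncomputable def mulX (δ : Derivation k R R) : Module.End k (Polynomial R) where
  toFun p := Polynomial.X * p + p.sum fun j b => Polynomial.monomial j (δ b)
  map_add' p q := by
    rw [Polynomial.sum_add_index p q (fun j b => Polynomial.monomial j (δ b)) (by simp) (by simp)]
    ring
  map_smul' c p := by
    have h : ∀ q : Polynomial R, ∀ n,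
        (q.sum fun j b => Polynomial.monomial j (δ b)).coeff n = δ (q.coeff n) := by
      intro q n
      by_cases hn : q.coeff n = 0 <;> simp [Polynomial.sum_def, Polynomial.coeff_monomial, hn]
    ext n
    simp only [RingHom.id_apply, smul_add, Polynomial.coeff_add, h, Polynomial.coeff_smul,
      Derivation.map_smul, Algebra.mul_smul_comm]

theorem mulX_monomial (δ : Derivation k R R) (j : ℕ) (b : R) :
    mulX δ (Polynomial.monomial j b) =
      Polynomial.monomial (j + 1) b + Polynomial.monomial j (δ b) := by
  simp [mulX, Polynomial.sum_monomial_index, Polynomial.X_mul_monomial]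

/-- Left multiplication by `p = ∑ aᵢ xⁱ` on left polynomials: `q ↦ ∑ aᵢ (x * (x * ⋯ (x * q)))`. -/
noncomputable def mulLeft (δ : Derivation k R R) : Polynomial R →+ Module.End k (Polynomial R) where
  toFun p := p.sum fun i a => LinearMap.mulLeft k (Polynomial.C a) * mulX δ ^ i
  map_zero' := by simp
  map_add' p q := by
    apply Polynomial.sum_add_index
    · intro i
      ext; simp
    · intro i a b
      rw [← add_mul]
      congr 1
      ext; simp [add_mul]

theorem mulLeft_monomial (δ : Derivation k R R) (i : ℕ) (a : R) :
    mulLeft δ (Polynomial.monomial i a) = LinearMap.mulLeft k (Polynomial.C a) * mulX δ ^ i := by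
  simp only [mulLeft, AddMonoidHom.coe_mk, ZeroHom.coe_mk]
  apply Polynomial.sum_monomial_index
  ext; simp

theorem mulLeft_C_mul (δ : Derivation k R R) (a : R) (q : Polynomial R) :
    mulLeft δ (Polynomial.C a * q) = LinearMap.mulLeft k (Polynomial.C a) * mulLeft δ q := by
  induction q using Polynomial.induction_on' with
  | add p q hp hq => rw [mul_add, map_add, map_add, hp, hq, mul_add]
  | monomial j b =>
    rw [Polynomial.C_mul_monomial, mulLeft_monomial, mulLeft_monomial, ← mul_assoc]
    congr 1
    ext; simp

theorem mulX_C_mul (δ : Derivation k R R) (a : R) (q : Polynomial R) :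
    mulX δ (Polynomial.C a * q) = Polynomial.C a * mulX δ q + Polynomial.C (δ a) * q := by
  induction q using Polynomial.induction_on' with
  | add p q hp hq => rw [mul_add, map_add, map_add, hp, hq]; ring
  | monomial j b =>
    simp only [Polynomial.C_mul_monomial, mulX_monomial, mul_add, Derivation.leibniz, smul_eq_mul,
      map_add, mul_comm b, add_assoc]

theorem mulLeft_mulX (δ : Derivation k R R) (q : Polynomial R) :
    mulLeft δ (mulX δ q) = mulX δ * mulLeft δ q := by
  induction q using Polynomial.induction_on' with
  | add p q hp hq => rw [map_add, map_add, map_add, hp, hq, mul_add]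
  | monomial j b =>
    rw [mulX_monomial, map_add, mulLeft_monomial, mulLeft_monomial, mulLeft_monomial]
    refine LinearMap.ext fun q => ?_
    simp only [LinearMap.add_apply, Module.End.mul_apply, LinearMap.mulLeft_apply, mulX_C_mul]
    rw [pow_succ', Module.End.mul_apply]

theorem mulLeft_mulX_pow (δ : Derivation k R R) (i : ℕ) (q : Polynomial R) :
    mulLeft δ ((mulX δ ^ i) q) = mulX δ ^ i * mulLeft δ q := by
  induction i with
  | zero => simp
  | succ i ih => rw [pow_succ', Module.End.mul_apply, mulLeft_mulX, ih, mul_assoc]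

theorem mulLeft_mulLeft (δ : Derivation k R R) (p q : Polynomial R) :
    mulLeft δ (mulLeft δ p q) = mulLeft δ p * mulLeft δ q := by
  induction p using Polynomial.induction_on' with
  | add p p' hp hp' => rw [map_add, LinearMap.add_apply, map_add, hp, hp', add_mul]
  | monomial i a =>
    rw [mulLeft_monomial, Module.End.mul_apply, LinearMap.mulLeft_apply, mulLeft_C_mul,
      mulLeft_mulX_pow, mul_assoc]

theorem mulX_pow_one (δ : Derivation k R R) (i : ℕ) :
    (mulX δ ^ i) 1 = Polynomial.monomial i 1 := by
  induction i with
  | zero => rw [pow_zero, Module.End.one_apply, Polynomial.monomial_zero_one]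
  | succ i ih => rw [pow_succ', Module.End.mul_apply, ih, mulX_monomial]; simp

theorem mulLeft_one_right (δ : Derivation k R R) (p : Polynomial R) : mulLeft δ p 1 = p := by
  induction p using Polynomial.induction_on' with
  | add p q hp hq => rw [map_add, LinearMap.add_apply, hp, hq]
  | monomial i a =>
    rw [mulLeft_monomial, Module.End.mul_apply, mulX_pow_one]
    simp [Polynomial.C_mul_monomial]

theorem mulLeft_C (δ : Derivation k R R) (a : R) (q : Polynomial R) :
    mulLeft δ (Polynomial.C a) q = Polynomial.C a * q := by
  rw [← Polynomial.monomial_zero_left, mulLeft_monomial]; simp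

noncomputable instance (δ : Derivation k R R) : Ring (SkewPoly δ) where
  __ := (inferInstance : AddCommGroup (SkewPoly δ))
  mul p q := (toPoly δ).symm (mulLeft δ (toPoly δ p) (toPoly δ q))
  one := (toPoly δ).symm 1
  mul_assoc p q r := congrArg (toPoly δ).symm
    (LinearMap.congr_fun (mulLeft_mulLeft δ (toPoly δ p) (toPoly δ q)) (toPoly δ r))
  one_mul p := (mulLeft_C δ 1 (toPoly δ p)).trans (by rw [Polynomial.C_1, one_mul]; rfl)
  mul_one p := mulLeft_one_right δ (toPoly δ p)
  left_distrib p q r := map_add (mulLeft δ (toPoly δ p)) (toPoly δ q) (toPoly δ r)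
  right_distrib p q r :=
    LinearMap.congr_fun (map_add (mulLeft δ) (toPoly δ p) (toPoly δ q)) (toPoly δ r)
  zero_mul p := LinearMap.congr_fun (map_zero (mulLeft δ)) (toPoly δ p)
  mul_zero p := map_zero (mulLeft δ (toPoly δ p))

theorem toPoly_mul (δ : Derivation k R R) (p q : SkewPoly δ) :
    toPoly δ (p * q) = mulLeft δ (toPoly δ p) (toPoly δ q) := rfl

theorem toPoly_one (δ : Derivation k R R) : toPoly δ 1 = 1 := rfl

/-- The inclusion of `R` in `R[x;δ]`, as a ring homomorphism. -/
noncomputable def C (δ : Derivation k R R) : R →+* SkewPoly δ where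
  toFun a := (toPoly δ).symm (Polynomial.C a)
  map_one' := congrArg (toPoly δ).symm Polynomial.C_1
  map_zero' := congrArg (toPoly δ).symm Polynomial.C_0
  map_add' _ _ := congrArg (toPoly δ).symm Polynomial.C_add
  map_mul' a b := congrArg (toPoly δ).symm
    (Polynomial.C_mul.trans (mulLeft_C δ a (Polynomial.C b)).symm)

/-- The variable `x` of `R[x;δ]`. -/
noncomputable def X (δ : Derivation k R R) : SkewPoly δ := (toPoly δ).symm Polynomial.X

theorem toPoly_C (δ : Derivation k R R) (a : R) : toPoly δ (C δ a) = Polynomial.C a := rfl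

theorem toPoly_C_mul (δ : Derivation k R R) (a : R) (p : SkewPoly δ) :
    toPoly δ (C δ a * p) = Polynomial.C a * toPoly δ p :=
  mulLeft_C δ a (toPoly δ p)

theorem toPoly_X_mul (δ : Derivation k R R) (p : SkewPoly δ) :
    toPoly δ (X δ * p) = mulX δ (toPoly δ p) := by
  rw [toPoly_mul, X, AddEquiv.apply_symm_apply, ← Polynomial.monomial_one_one_eq_X,
    mulLeft_monomial]
  simp

/-- The defining relation `x r = r x + δ r`. -/
theorem X_mul_C (δ : Derivation k R R) (a : R) : X δ * C δ a = C δ a * X δ + C δ (δ a) := by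
  apply (toPoly δ).injective
  rw [map_add, toPoly_X_mul, toPoly_C_mul, toPoly_C, toPoly_C, ← Polynomial.monomial_zero_left,
    mulX_monomial]
  simp [X, Polynomial.monomial_zero_left, Polynomial.C_mul_X_eq_monomial]

/-- The powers of `x` form a basis of `R[x;δ]` as a left `R`-module. -/
theorem toPoly_C_mul_X_pow (δ : Derivation k R R) (a : R) (n : ℕ) :
    toPoly δ (C δ a * X δ ^ n) = Polynomial.monomial n a := by
  have h : ∀ n : ℕ, toPoly δ (X δ ^ n) = Polynomial.monomial n 1 := by
    intro n
    induction n with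
    | zero => rw [pow_zero, toPoly_one, ← Polynomial.C_1, Polynomial.monomial_zero_left]
    | succ n ih => rw [pow_succ', toPoly_X_mul, ih, mulX_monomial]; simp
  rw [toPoly_C_mul, h, Polynomial.C_mul_monomial, mul_one]

/-- `R[x;δ]` is a `k`-algebra, the scalars acting through `k → R → R[x;δ]`. -/
noncomputable instance (δ : Derivation k R R) : Algebra k (SkewPoly δ) :=
  RingHom.toAlgebra' ((C δ).comp (algebraMap k R)) <| by
    intro c p
    apply (toPoly δ).injective
    have h : Polynomial.C (algebraMap k R c) = c • (1 : Polynomial R) := by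
      rw [← Polynomial.C_1, Polynomial.smul_C, Algebra.algebraMap_eq_smul_one]
    rw [RingHom.comp_apply, toPoly_C_mul, toPoly_mul, toPoly_C, h, map_smul, mulLeft_one_right,
      smul_mul_assoc, one_mul]

end SkewPoly

end SkewPolynomialRing

/-! ### The Dixmier-Moeglin equivalence -/

section DixmierMoeglin

variable (k : Type u) {A : Type v} [Field k] [Ring A] [Algebra k A]

/-- Prime ideals of a not necessarily commutative ring: `P` is a proper two-sided ideal such that
`a A b ⊆ P` implies `a ∈ P` or `b ∈ P`. -/
def TwoSidedIdeal.IsPrimeIdeal (P : TwoSidedIdeal A) : Prop :=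
  P ≠ ⊤ ∧ ∀ a b : A, (∀ r : A, a * r * b ∈ P) → a ∈ P ∨ b ∈ P

/-- `P` is (left) primitive: it is the annihilator of a simple left `A`-module. -/
def TwoSidedIdeal.IsPrimitiveIdeal (P : TwoSidedIdeal A) : Prop :=
  ∃ (M : Type v) (_ : AddCommGroup M) (_ : Module A M),
    IsSimpleModule A M ∧ P.asIdeal = Module.annihilator A M

/-- `P` is locally closed: the intersection of all the prime ideals of `A` that properly contain
`P` (which is `A` if there is none) properly contains `P`. -/
def TwoSidedIdeal.IsLocallyClosedIdeal (P : TwoSidedIdeal A) : Prop :=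
  P < sInf {Q : TwoSidedIdeal A | Q.IsPrimeIdeal ∧ P < Q}

/-- `P` is rational: the centre of the Goldie quotient ring of `A / P` is a field and algebraic
over `k`. The Goldie quotient ring is the ring of fractions `s⁻¹ a` with `s` a regular element
(that is, not a left or right zero divisor) of `A / P`. The data `OreSet` is the Ore condition,
which says that these fractions form a ring; the ring does not depend on the choices in this
data, and the condition holds for every prime ideal `P` of a noetherian ring. -/
def TwoSidedIdeal.IsRationalIdeal (P : TwoSidedIdeal A) : Prop :=
  ∃ _ : OreLocalization.OreSet (A ⧸ P.asIdeal)⁰,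
    IsField (Subalgebra.center k (OreLocalization (A ⧸ P.asIdeal)⁰ (A ⧸ P.asIdeal))) ∧
      Algebra.IsAlgebraic k
        (Subalgebra.center k (OreLocalization (A ⧸ P.asIdeal)⁰ (A ⧸ P.asIdeal)))

variable (A) in
/-- The Dixmier-Moeglin equivalence for a (noetherian) `k`-algebra `A`: for every prime ideal,
being primitive, locally closed and rational are equivalent. -/
def SatisfiesDME : Prop :=
  ∀ P : TwoSidedIdeal A, P.IsPrimeIdeal →
    (P.IsPrimitiveIdeal ↔ P.IsLocallyClosedIdeal) ∧ (P.IsLocallyClosedIdeal ↔ P.IsRationalIdeal k)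

end DixmierMoeglin

/-! ### The differential Dixmier-Moeglin equivalence -/

section FractionField

variable {k : Type u} {S : Type v} [CommRing k] [CommRing S] [IsDomain S] [Algebra k S]

/-- The value at a fraction of the extension of a derivation `d` of a domain to its field of
fractions, by the quotient rule. The fraction is written as `a / b` with a chosen `a` and `b`;
`fracDerivFun_div` shows that the choice does not matter. -/
noncomputable def fracDerivFun (d : Derivation k S S) (f : FractionRing S) : FractionRing S :=
  let a := (IsLocalization.sec S⁰ f).1
  let b : S := (IsLocalization.sec S⁰ f).2
  algebraMap S (FractionRing S) (b * d a - a * d b) / algebraMap S (FractionRing S) b ^ 2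

theorem fracDerivFun_div (d : Derivation k S S) (a b : S) (hb : b ≠ 0) :
    fracDerivFun d (algebraMap S (FractionRing S) a / algebraMap S (FractionRing S) b) =
      algebraMap S (FractionRing S) (b * d a - a * d b) / algebraMap S (FractionRing S) b ^ 2 := by
  have inj := IsFractionRing.injective S (FractionRing S)
  have hb' : algebraMap S (FractionRing S) b ≠ 0 := by simpa using hb
  set f := algebraMap S (FractionRing S) a / algebraMap S (FractionRing S) b with hf
  obtain ⟨a', b', h⟩ : ∃ a' b', IsLocalization.sec S⁰ f = (a', b') := ⟨_, _, rfl⟩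
  have hspec := IsLocalization.sec_spec S⁰ f
  rw [h] at hspec
  have hc : (b' : S) ≠ 0 := nonZeroDivisors.coe_ne_zero b'
  have hc' : algebraMap S (FractionRing S) (b' : S) ≠ 0 := by simp
  have key : a * b' = a' * b := by
    apply inj
    rw [map_mul, map_mul, ← hspec, hf]
    field_simp
  have hd : a * d (b' : S) + b' * d a = a' * d b + b * d a' := by
    simpa [Derivation.leibniz] using congrArg d key
  simp only [fracDerivFun, h]
  rw [div_eq_div_iff (pow_ne_zero 2 hc') (pow_ne_zero 2 hb'), ← map_pow, ← map_pow, ← map_mul,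
    ← map_mul]
  congr 1
  linear_combination (-(b' : S) * b) * hd + (b * d (b' : S) + b' * d b) * key

/-- The unique extension of a derivation of a domain to its field of fractions. -/
noncomputable def fracDeriv (d : Derivation k S S) :
    Derivation k (FractionRing S) (FractionRing S) :=
  Derivation.mk'
    { toFun := fracDerivFun d
      map_add' := by
        intro f g
        obtain ⟨a, b, hb, rfl⟩ := IsFractionRing.div_surjective (A := S) f
        obtain ⟨a', b', hb', rfl⟩ := IsFractionRing.div_surjective (A := S) g
        have hb := nonZeroDivisors.ne_zero hb
        have hb' := nonZeroDivisors.ne_zero hb'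
        have h1 : algebraMap S (FractionRing S) b ≠ 0 := by simpa using hb
        have h2 : algebraMap S (FractionRing S) b' ≠ 0 := by simpa using hb'
        rw [div_add_div _ _ h1 h2, ← map_mul, ← map_mul, ← map_mul, ← map_add,
          fracDerivFun_div d _ _ (mul_ne_zero hb hb'), fracDerivFun_div d _ _ hb,
          fracDerivFun_div d _ _ hb']
        simp only [map_add, map_mul, map_sub, Derivation.leibniz, smul_eq_mul]
        field_simp
        ring
      map_smul' := by
        intro c f
        obtain ⟨a, b, hb, rfl⟩ := IsFractionRing.div_surjective (A := S) f
        have hb := nonZeroDivisors.ne_zero hb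
        have h : c • (algebraMap S (FractionRing S) a / algebraMap S (FractionRing S) b) =
            algebraMap S (FractionRing S) (c • a) / algebraMap S (FractionRing S) b := by
          rw [Algebra.smul_def, Algebra.smul_def, map_mul, mul_div_assoc,
            IsScalarTower.algebraMap_apply k S (FractionRing S)]
        rw [h, fracDerivFun_div d _ _ hb, fracDerivFun_div d _ _ hb, RingHom.id_apply,
          Derivation.map_smul, mul_smul_comm, smul_mul_assoc, ← smul_sub,
          Algebra.smul_def c (_ / _ : FractionRing S), Algebra.smul_def c (_ - _ : S), map_mul,
          mul_div_assoc, IsScalarTower.algebraMap_apply k S (FractionRing S)] }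
    (by
      intro f g
      obtain ⟨a, b, hb, rfl⟩ := IsFractionRing.div_surjective (A := S) f
      obtain ⟨a', b', hb', rfl⟩ := IsFractionRing.div_surjective (A := S) g
      have hb := nonZeroDivisors.ne_zero hb
      have hb' := nonZeroDivisors.ne_zero hb'
      have h1 : algebraMap S (FractionRing S) b ≠ 0 := by simpa using hb
      have h2 : algebraMap S (FractionRing S) b' ≠ 0 := by simpa using hb'
      simp only [LinearMap.coe_mk, AddHom.coe_mk]
      rw [div_mul_div_comm, ← map_mul, ← map_mul, fracDerivFun_div d _ _ (mul_ne_zero hb hb'),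
        fracDerivFun_div d _ _ hb, fracDerivFun_div d _ _ hb']
      simp only [map_mul, map_sub, map_add, Derivation.leibniz, smul_eq_mul]
      field_simp
      ring)

theorem fracDeriv_algebraMap (d : Derivation k S S) (a : S) :
    fracDeriv d (algebraMap S (FractionRing S) a) = algebraMap S (FractionRing S) (d a) := by
  have h := fracDerivFun_div d a 1 one_ne_zero
  simp only [map_one, div_one, one_mul, Derivation.map_one_eq_zero, mul_zero, sub_zero,
    one_pow] at h
  exact h

end FractionField

section DeltaDixmierMoeglin

variable {k : Type u} {R : Type v} [Field k] [CommRing R] [Algebra k R]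

/-- Prime `δ`-ideals: prime ideals `P` with `δ P ⊆ P`. -/
structure IsPrimeDeltaIdeal (δ : Derivation k R R) (P : Ideal R) : Prop where
  isPrime : P.IsPrime
  deriv_mem : ∀ r ∈ P, δ r ∈ P

theorem IsPrimeDeltaIdeal.mk_deriv_eq_zero {δ : Derivation k R R} {P : Ideal R}
    (hP : IsPrimeDeltaIdeal δ P) (x : R) (hx : Ideal.Quotient.mkₐ k P x = 0) :
    Ideal.Quotient.mkₐ k P (δ x) = 0 := by
  rw [Ideal.Quotient.mkₐ_eq_mk, Ideal.Quotient.eq_zero_iff_mem] at hx ⊢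
  exact hP.deriv_mem x hx

/-- The derivation of `R / P` induced by `δ`. -/
noncomputable def quotientDeriv (δ : Derivation k R R) (P : Ideal R)
    (hP : IsPrimeDeltaIdeal δ P) : Derivation k (R ⧸ P) (R ⧸ P) :=
  Derivation.liftOfSurjective (f := Ideal.Quotient.mkₐ k P) (Ideal.Quotient.mkₐ_surjective k P)
    (d := δ) hP.mk_deriv_eq_zero

theorem quotientDeriv_mk (δ : Derivation k R R) (P : Ideal R) (hP : IsPrimeDeltaIdeal δ P)
    (r : R) : quotientDeriv δ P hP (Ideal.Quotient.mk P r) = Ideal.Quotient.mk P (δ r) :=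
  Derivation.liftOfSurjective_apply (f := Ideal.Quotient.mkₐ k P)
    (Ideal.Quotient.mkₐ_surjective k P) hP.mk_deriv_eq_zero r

/-- `P` is `δ`-primitive: there is a maximal ideal `m` of `R` such that `P` is maximal among the
prime `δ`-ideals contained in `m`. -/
def IsDeltaPrimitive (δ : Derivation k R R) (P : Ideal R) : Prop :=
  ∃ m : Ideal R, m.IsMaximal ∧ Maximal (fun Q : Ideal R => IsPrimeDeltaIdeal δ Q ∧ Q ≤ m) P

/-- `P` is `δ`-locally closed: the intersection of all the prime `δ`-ideals of `R` that properly
contain `P` (which is `R` if there is none) properly contains `P`. -/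
def IsDeltaLocallyClosed (δ : Derivation k R R) (P : Ideal R) : Prop :=
  P < sInf {Q : Ideal R | IsPrimeDeltaIdeal δ Q ∧ P < Q}

/-- `P` is `δ`-rational: the constants of the derivation induced by `δ` on the field of fractions
of `R / P` are algebraic over `k`. -/
def IsDeltaRational (δ : Derivation k R R) (P : Ideal R) (hP : IsPrimeDeltaIdeal δ P) : Prop :=
  haveI := hP.isPrime
  ∀ f : FractionRing (R ⧸ P), fracDeriv (quotientDeriv δ P hP) f = 0 → IsAlgebraic k f

/-- The `δ`-Dixmier-Moeglin equivalence for `(R, δ)`: for every prime `δ`-ideal, being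
`δ`-primitive, `δ`-locally closed and `δ`-rational are equivalent. -/
def SatisfiesDeltaDME (δ : Derivation k R R) : Prop :=
  ∀ (P : Ideal R) (hP : IsPrimeDeltaIdeal δ P),
    (IsDeltaPrimitive δ P ↔ IsDeltaLocallyClosed δ P) ∧
      (IsDeltaLocallyClosed δ P ↔ IsDeltaRational δ P hP)

end DeltaDixmierMoeglin

/-!
Write `A = R[x;δ]`. For a prime ideal `P` of `A` the contraction `p = P ∩ R` is a prime `δ`-ideal:
it is prime with respect to products of `δ`-stable ideals, and in characteristic zero this makes it
radical, after which the ideals `(p : a)` are `δ`-stable and `p` is prime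
(`SkewPoly.isPrimeDeltaIdeal_contraction`). There are two cases.

* Suppose that `P` does not contain `δ(R)`. Commuting with an element of `R` acts like
  differentiation in `x`, so that every nonzero ideal of `(R/p)[x;δ]` meets `R/p`, and therefore
  `P = pA` (`SkewPoly.eq_extension_contraction`). Each property of `P` then amounts to its
  differential counterpart for `p`.
  - Local closedness: contraction and extension of prime ideals
    (`SkewPoly.isLocallyClosedIdeal_iff`).
  - Rationality: for a central fraction `z` over `(R/p)[x;δ]`, the denominators of `z` form a
    two-sided ideal, so `z` has a denominator in `R/p`, and its numerator, commuting with `R/p`, has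
    degree zero. The centre is thus the field of constants of `Frac(R/p)`
    (`SkewPoly.isRationalIdeal_iff`).
  - Primitivity: if `p` is maximal among the prime `δ`-ideals inside a maximal ideal `m`, then `P`
    annihilates any simple quotient of `A/Am` (`SkewPoly.isPrimitiveIdeal_of_isDeltaPrimitive`). The
    converse `SkewPoly.isDeltaPrimitive_of_isPrimitiveIdeal` is an elementary form of generic
    flatness for a simple module `Av`, filtered by the subgroups `∑_{i < n} xⁱ R v`.

* Suppose that `P` contains `δ(R)`. Then `A/P` is a commutative affine domain, and all three
  properties of `P` say that `A/P` is a field, by the Nullstellensatz.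
-/

/-! ### Arithmetic of skew polynomials -/

namespace SkewPoly

section Arithmetic

variable {k : Type u} {R : Type v} [CommRing k] [CommRing R] [Algebra k R] (δ : Derivation k R R)

theorem coeff_sum_monomial_deriv (p : Polynomial R) (n : ℕ) :
    (p.sum fun j b => Polynomial.monomial j (δ b)).coeff n = δ (p.coeff n) := by
  by_cases hn : p.coeff n = 0 <;> simp [Polynomial.sum_def, Polynomial.coeff_monomial, hn]

theorem coeff_mulX_zero (p : Polynomial R) : (mulX δ p).coeff 0 = δ (p.coeff 0) := by
  change (Polynomial.X * p + p.sum fun j b => Polynomial.monomial j (δ b)).coeff 0 = _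
  rw [Polynomial.coeff_add, coeff_sum_monomial_deriv]; simp

theorem coeff_mulX_succ (p : Polynomial R) (n : ℕ) :
    (mulX δ p).coeff (n + 1) = p.coeff n + δ (p.coeff (n + 1)) := by
  change (Polynomial.X * p + p.sum fun j b => Polynomial.monomial j (δ b)).coeff (n + 1) = _
  rw [Polynomial.coeff_add, coeff_sum_monomial_deriv, Polynomial.coeff_X_mul]

variable {δ} in
theorem ext_coeff {f g : SkewPoly δ} (h : ∀ n, (toPoly δ f).coeff n = (toPoly δ g).coeff n) :
    f = g :=
  (toPoly δ).injective (Polynomial.ext h)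

variable {δ} in
@[elab_as_elim]
theorem induction_on {motive : SkewPoly δ → Prop} (f : SkewPoly δ)
    (add : ∀ f g, motive f → motive g → motive (f + g))
    (monomial : ∀ a i, motive (C δ a * X δ ^ i)) : motive f := by
  have h : ∀ p : Polynomial R, motive ((toPoly δ).symm p) := by
    intro p
    induction p using Polynomial.induction_on' with
    | add p q hp hq => rw [map_add]; exact add _ _ hp hq
    | monomial i a =>
      rw [← toPoly_C_mul_X_pow δ, AddEquiv.symm_apply_apply]; exact monomial a i
  simpa using h (toPoly δ f)

theorem algebraMap_eq (c : k) : algebraMap k (SkewPoly δ) c = C δ (algebraMap k R c) := rfl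

theorem mulLeft_eq_sum_range (p q : Polynomial R) {N : ℕ} (hN : p.natDegree < N) :
    mulLeft δ p q =
      ∑ i ∈ Finset.range N, Polynomial.C (p.coeff i) * (mulX δ ^ i) q := by
  have h : mulLeft δ p = p.sum fun i a => LinearMap.mulLeft k (Polynomial.C a) * mulX δ ^ i := rfl
  rw [h, Polynomial.sum_over_range' _ _ _ hN, LinearMap.sum_apply]
  · rfl
  · intro i; ext; simp

theorem coeff_mulX_pow_top {q : Polynomial R} {n : ℕ} (hq : q.natDegree ≤ n) (i : ℕ) :
    (∀ j, n + i < j → ((mulX δ ^ i) q).coeff j = 0) ∧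
      ((mulX δ ^ i) q).coeff (n + i) = q.coeff n := by
  induction i with
  | zero =>
    refine ⟨fun j hj => ?_, by simp⟩
    simpa using Polynomial.coeff_eq_zero_of_natDegree_lt (by lia : q.natDegree < j)
  | succ i ih =>
    rw [pow_succ', Module.End.mul_apply]
    refine ⟨fun j hj => ?_, ?_⟩
    · obtain ⟨j, rfl⟩ : ∃ l, j = l + 1 := ⟨j - 1, by lia⟩
      rw [coeff_mulX_succ, ih.1 _ (by lia), ih.1 _ (by lia), map_zero, add_zero]
    · rw [← add_assoc, coeff_mulX_succ, ih.2, ih.1 _ (by lia), map_zero, add_zero]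

theorem coeff_mulLeft_top {p q : Polynomial R} {m n : ℕ} (hp : p.natDegree ≤ m)
    (hq : q.natDegree ≤ n) :
    (∀ j, m + n < j → (mulLeft δ p q).coeff j = 0) ∧
      (mulLeft δ p q).coeff (m + n) = p.coeff m * q.coeff n := by
  rw [mulLeft_eq_sum_range δ p q (Nat.lt_succ_of_le hp)]
  simp only [Polynomial.finsetSum_coeff, Polynomial.coeff_C_mul]
  refine ⟨fun j hj => Finset.sum_eq_zero fun i hi => ?_, ?_⟩
  · rw [(coeff_mulX_pow_top δ hq i).1 j (by have := Finset.mem_range.1 hi; lia), mul_zero]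
  · rw [Finset.sum_range_succ, Finset.sum_eq_zero, zero_add, add_comm m n,
      (coeff_mulX_pow_top δ hq m).2]
    intro i hi
    rw [(coeff_mulX_pow_top δ hq i).1 _ (by have := Finset.mem_range.1 hi; lia), mul_zero]

theorem natDegree_mul_le (f g : SkewPoly δ) :
    (toPoly δ (f * g)).natDegree ≤ (toPoly δ f).natDegree + (toPoly δ g).natDegree := by
  rw [Polynomial.natDegree_le_iff_coeff_eq_zero]
  exact (coeff_mulLeft_top δ le_rfl le_rfl).1

instance [IsDomain R] : NoZeroDivisors (SkewPoly δ) where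
  eq_zero_or_eq_zero_of_mul_eq_zero {f g} h := by
    by_contra! hfg
    have hf : toPoly δ f ≠ 0 := fun h => hfg.1 ((toPoly δ).map_eq_zero_iff.1 h)
    have hg : toPoly δ g ≠ 0 := fun h => hfg.2 ((toPoly δ).map_eq_zero_iff.1 h)
    have h1 := (coeff_mulLeft_top δ (p := toPoly δ f) (q := toPoly δ g) le_rfl le_rfl).2
    rw [← toPoly_mul, h, map_zero, Polynomial.coeff_zero] at h1
    exact mul_ne_zero (Polynomial.leadingCoeff_ne_zero.2 hf)
      (Polynomial.leadingCoeff_ne_zero.2 hg) h1.symm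

theorem C_injective : Function.Injective (C δ) :=
  (toPoly δ).symm.injective.comp Polynomial.C_injective

instance [Nontrivial R] : Nontrivial (SkewPoly δ) := (C_injective δ).nontrivial

/-- Iterating `x r = r x + δ r`: one has `xⁱ r = ∑ⱼ (i choose j) δⁱ⁻ʲ(r) xʲ`. -/
theorem coeff_mulX_pow_C (r : R) (i j : ℕ) :
    ((mulX δ ^ i) (Polynomial.C r)).coeff j = (i.choose j : R) * δ^[i - j] r := by
  induction i generalizing j with
  | zero => cases j <;> simp [Polynomial.coeff_C]
  | succ i ih =>
    have hc (n l : ℕ) : δ ((n : R) * l.iterate δ r) = n * δ^[l + 1] r := by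
      rw [← nsmul_eq_mul, map_nsmul, nsmul_eq_mul, Function.iterate_succ_apply']
    rw [pow_succ', Module.End.mul_apply]
    cases j with
    | zero => rw [coeff_mulX_zero, ih, hc]; simp
    | succ j =>
      rw [coeff_mulX_succ, ih, ih, hc, Nat.choose_succ_succ, Nat.succ_sub_succ]
      rcases lt_or_ge i (j + 1) with h | h
      · simp [Nat.choose_eq_zero_of_lt h]
      · rw [show i - (j + 1) + 1 = i - j by lia]; push_cast; ring

theorem coeff_mul_C (f : SkewPoly δ) (r : R) {N : ℕ} (hN : (toPoly δ f).natDegree < N) (j : ℕ) :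
    (toPoly δ (f * C δ r)).coeff j =
      ∑ i ∈ Finset.range N, (toPoly δ f).coeff i * ((i.choose j : R) * δ^[i - j] r) := by
  rw [toPoly_mul, mulLeft_eq_sum_range δ _ _ hN, Polynomial.finsetSum_coeff]
  simp only [Polynomial.coeff_C_mul, toPoly_C, coeff_mulX_pow_C]

/-- Commuting with an element of `R` lowers the degree, and the new leading coefficient is the one
of the formal derivative in `x`, times `δ r`. -/
theorem coeff_commutator_C (f : SkewPoly δ) (r : R) {n : ℕ}
    (hn : (toPoly δ f).natDegree ≤ n + 1) :
    (∀ j, n < j → (toPoly δ (f * C δ r - C δ r * f)).coeff j = 0) ∧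
      (toPoly δ (f * C δ r - C δ r * f)).coeff n =
        ((n + 1 : ℕ) : R) * (toPoly δ f).coeff (n + 1) * δ r := by
  have h0 (j : ℕ) : (toPoly δ (f * C δ r - C δ r * f)).coeff j =
      ∑ i ∈ Finset.range (n + 2), (toPoly δ f).coeff i * ((i.choose j : R) * δ^[i - j] r) -
        r * (toPoly δ f).coeff j := by
    rw [map_sub, Polynomial.coeff_sub, coeff_mul_C δ f r (by lia : _ < n + 2), toPoly_C_mul,
      Polynomial.coeff_C_mul]
  have hz (m j : ℕ) (hm : m ≤ j) : ∑ i ∈ Finset.range m,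
      (toPoly δ f).coeff i * ((i.choose j : R) * δ^[i - j] r) = 0 :=
    Finset.sum_eq_zero fun i hi => by
      rw [Nat.choose_eq_zero_of_lt ((Finset.mem_range.1 hi).trans_le hm)]; simp
  refine ⟨fun j hj => ?_, ?_⟩
  · rw [h0]
    rcases (Nat.succ_le_of_lt hj).eq_or_lt with rfl | hj'
    · rw [Finset.sum_range_succ, hz _ _ le_rfl]; simp [mul_comm]
    · rw [hz _ _ hj', Polynomial.coeff_eq_zero_of_natDegree_lt (by lia)]; simp
  · rw [h0, Finset.sum_range_succ, Finset.sum_range_succ, hz _ _ le_rfl]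
    simp
    ring

end Arithmetic

section Map

variable {k : Type u} {R S : Type v} [CommRing k] [CommRing R] [Algebra k R] [CommRing S]
  [Algebra k S] {δ : Derivation k R R} {d : Derivation k S S}

theorem map_mulX (φ : R →ₐ[k] S) (h : ∀ r, φ (δ r) = d (φ r)) (p : Polynomial R) :
    (mulX δ p).map (φ : R →+* S) = mulX d (p.map (φ : R →+* S)) := by
  ext n
  cases n with
  | zero => simp [coeff_mulX_zero, h]
  | succ n => simp [coeff_mulX_succ, h]

theorem map_mulLeft (φ : R →ₐ[k] S) (h : ∀ r, φ (δ r) = d (φ r)) (p q : Polynomial R) :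
    (mulLeft δ p q).map (φ : R →+* S) =
      mulLeft d (p.map (φ : R →+* S)) (q.map (φ : R →+* S)) := by
  have hX (i : ℕ) : ((mulX δ ^ i) q).map (φ : R →+* S) = (mulX d ^ i) (q.map (φ : R →+* S)) := by
    induction i with
    | zero => simp
    | succ i ih =>
      rw [pow_succ', Module.End.mul_apply, map_mulX φ h, ih, pow_succ', Module.End.mul_apply]
  rw [mulLeft_eq_sum_range δ p q p.natDegree.lt_succ_self,
    mulLeft_eq_sum_range d _ _ (Nat.lt_succ_of_le Polynomial.natDegree_map_le)]
  simp [Polynomial.map_sum, hX]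

/-- The homomorphism `R[x;δ] → S[x;d]` applying to the coefficients a homomorphism `φ : R → S`
that intertwines the derivations. -/
noncomputable def map (φ : R →ₐ[k] S) (h : ∀ r, φ (δ r) = d (φ r)) :
    SkewPoly δ →ₐ[k] SkewPoly d where
  toFun f := (toPoly d).symm ((toPoly δ f).map (φ : R →+* S))
  map_one' := congrArg (toPoly d).symm (Polynomial.map_one _)
  map_zero' := congrArg (toPoly d).symm (Polynomial.map_zero _)
  map_add' _ _ := congrArg (toPoly d).symm (Polynomial.map_add _)
  map_mul' f g := congrArg (toPoly d).symm (map_mulLeft φ h (toPoly δ f) (toPoly δ g))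
  commutes' c := congrArg (toPoly d).symm <| by
    rw [algebraMap_eq, toPoly_C, Polynomial.map_C]; simp; rfl

variable (φ : R →ₐ[k] S) (h : ∀ r, φ (δ r) = d (φ r))

theorem toPoly_map (f : SkewPoly δ) :
    toPoly d (map φ h f) = (toPoly δ f).map (φ : R →+* S) := rfl

theorem map_C (r : R) : map φ h (C δ r) = C d (φ r) :=
  congrArg (toPoly d).symm (Polynomial.map_C _)

theorem map_surjective (hφ : Function.Surjective φ) : Function.Surjective (map φ h) := by
  intro g
  obtain ⟨p, hp⟩ := Polynomial.map_surjective (φ : R →+* S) hφ (toPoly d g)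
  exact ⟨(toPoly δ).symm p, (toPoly d).injective hp⟩

theorem map_apply_eq_zero_iff (f : SkewPoly δ) :
    map φ h f = 0 ↔ ∀ n, φ ((toPoly δ f).coeff n) = 0 := by
  rw [← (toPoly d).map_eq_zero_iff, toPoly_map, Polynomial.ext_iff]
  simp

end Map

end SkewPoly

/-! ### Contraction of prime ideals to the coefficient ring -/

section DeltaIdeals

variable {k : Type u} {R : Type v} [Field k] [CommRing R] [Algebra k R] {δ : Derivation k R R}

/-- In characteristic zero, differentiating `aⁿ ∈ I` repeatedly shows that the radical of a
`δ`-stable ideal is `δ`-stable. -/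
theorem deriv_mem_radical [CharZero k] {I : Ideal R} (hI : ∀ r ∈ I, δ r ∈ I) {a : R}
    (ha : a ∈ I.radical) : δ a ∈ I.radical := by
  obtain ⟨n, hn⟩ := ha
  suffices h : ∀ n e, a ^ n * δ a ^ e ∈ I → ∃ m, δ a ^ m ∈ I from
    h n 0 (by simpa using hn)
  intro n
  induction n with
  | zero => exact fun e he => ⟨e, by simpa using he⟩
  | succ n ih =>
    intro e he
    refine ih (e + 2) ?_
    -- `δ(aⁿ⁺¹ bᵉ) b = (n + 1) aⁿ bᵉ⁺² + e aⁿ⁺¹ bᵉ δ(b)` for `b = δ a`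
    have h1 : (((n + 1 : ℕ) : k)) • (a ^ n * δ a ^ (e + 2)) ∈ I := by
      have h2 := I.sub_mem (I.mul_mem_right (δ a) (hI _ he))
        (I.mul_mem_right ((e : R) * δ (δ a)) he)
      convert h2 using 1
      rw [Derivation.leibniz, Derivation.leibniz_pow, Derivation.leibniz_pow, Algebra.smul_def]
      cases e with
      | zero => simp; ring
      | succ e => simp; ring
    have h3 : ((n + 1 : ℕ) : k) ≠ 0 := Nat.cast_ne_zero.2 n.succ_ne_zero
    have h4 := Submodule.smul_of_tower_mem I (((n + 1 : ℕ) : k)⁻¹) h1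
    rwa [smul_smul, inv_mul_cancel₀ h3, one_smul] at h4

theorem deriv_mem_mul {I J : Ideal R} (hI : ∀ r ∈ I, δ r ∈ I) (hJ : ∀ r ∈ J, δ r ∈ J) {a : R}
    (ha : a ∈ I * J) : δ a ∈ I * J := by
  induction ha using Submodule.mul_induction_on' with
  | mem_mul_mem x hx y hy =>
    rw [Derivation.leibniz, smul_eq_mul, smul_eq_mul, mul_comm y]
    exact add_mem (Ideal.mul_mem_mul hx (hJ _ hy)) (Ideal.mul_mem_mul (hI _ hx) hy)
  | add x _ y _ hx hy => rw [map_add]; exact add_mem hx hy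

theorem deriv_mem_pow {I : Ideal R} (hI : ∀ r ∈ I, δ r ∈ I) (n : ℕ) :
    ∀ r ∈ I ^ n, δ r ∈ I ^ n := by
  induction n with
  | zero => simp
  | succ n ih => rw [pow_succ]; exact fun r hr => deriv_mem_mul ih hI hr

/-- For a radical `δ`-stable ideal `I`, the ideals `(I : a)` are `δ`-stable. -/
theorem mul_deriv_mem_of_isRadical {I : Ideal R} (hI : ∀ r ∈ I, δ r ∈ I) (hrad : I.IsRadical)
    {a b : R} (hab : a * b ∈ I) : a * δ b ∈ I := by
  refine hrad ⟨2, ?_⟩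
  have h1 := hI _ hab
  rw [Derivation.leibniz, smul_eq_mul, smul_eq_mul] at h1
  have h2 := I.sub_mem (I.mul_mem_left (a * δ b) h1) (I.mul_mem_left (δ b * δ a) hab)
  convert h2 using 1
  ring

/-- In a noetherian algebra of characteristic zero, a `δ`-stable ideal that is prime with respect
to products of `δ`-stable ideals is prime. -/
theorem isPrime_of_deltaPrime [CharZero k] [IsNoetherianRing R] {I : Ideal R}
    (hI : ∀ r ∈ I, δ r ∈ I) (hne : I ≠ ⊤)
    (hprime : ∀ J K : Ideal R, (∀ r ∈ J, δ r ∈ J) → (∀ r ∈ K, δ r ∈ K) → J * K ≤ I →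
      J ≤ I ∨ K ≤ I) : I.IsPrime := by
  have hrad : I.IsRadical := by
    have hN : ∀ r ∈ I.radical, δ r ∈ I.radical := fun r hr => deriv_mem_radical hI hr
    obtain ⟨n, hn⟩ := I.exists_radical_pow_le_of_fg (IsNoetherian.noetherian _)
    induction n with
    | zero =>
      rw [pow_zero, Ideal.one_eq_top] at hn
      exact absurd (top_le_iff.1 hn) hne
    | succ n ih => exact (hprime _ _ (deriv_mem_pow hN n) hN (by rwa [← pow_succ])).elim ih id
  refine ⟨hne, fun {a b} hab => ?_⟩
  let K : Ideal R := I.colon {a}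
  let J : Ideal R := I.colon (K : Set R)
  have hK : ∀ r ∈ K, δ r ∈ K := fun r hr => by
    rw [Submodule.mem_colon_singleton, smul_eq_mul, mul_comm] at hr ⊢
    exact mul_deriv_mem_of_isRadical hI hrad hr
  have hJ : ∀ r ∈ J, δ r ∈ J := fun r hr => by
    rw [Submodule.mem_colon] at hr ⊢
    intro s hs
    have := hr s hs
    rw [smul_eq_mul, mul_comm] at this ⊢
    exact mul_deriv_mem_of_isRadical hI hrad this
  have hb : b ∈ K := by rwa [Submodule.mem_colon_singleton, smul_eq_mul, mul_comm]
  have ha : a ∈ J := Submodule.mem_colon.2 fun s hs => by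
    have := Submodule.mem_colon_singleton.1 hs
    rwa [smul_eq_mul, mul_comm] at this
  refine (hprime J K hJ hK (Ideal.mul_le.2 fun r hr s hs => ?_)).imp (fun h => h ha)
    fun h => h hb
  exact Submodule.mem_colon.1 hr s hs

end DeltaIdeals

namespace SkewPoly

section Contraction

variable {k : Type u} {R : Type v} [Field k] [CommRing R] [Algebra k R] {δ : Derivation k R R}

/-- The contraction `P ∩ R` of an ideal `P` of `R[x;δ]`. -/
noncomputable def contraction (P : TwoSidedIdeal (SkewPoly δ)) : Ideal R := P.asIdeal.comap (C δ)

theorem mem_contraction {P : TwoSidedIdeal (SkewPoly δ)} {r : R} :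
    r ∈ contraction P ↔ C δ r ∈ P := Iff.rfl

theorem deriv_mem_contraction (P : TwoSidedIdeal (SkewPoly δ)) (r : R)
    (hr : r ∈ contraction P) : δ r ∈ contraction P := by
  rw [mem_contraction] at hr ⊢
  have h : C δ (δ r) = X δ * C δ r - C δ r * X δ := by rw [X_mul_C]; abel
  rw [h]
  exact P.sub_mem (P.mul_mem_left _ _ hr) (P.mul_mem_right _ _ hr)

theorem isPrimeDeltaIdeal_contraction [CharZero k] [IsNoetherianRing R]
    {P : TwoSidedIdeal (SkewPoly δ)} (hP : P.IsPrimeIdeal) :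
    IsPrimeDeltaIdeal δ (contraction P) := by
  refine ⟨isPrime_of_deltaPrime (δ := δ) (deriv_mem_contraction P) ?_ ?_, deriv_mem_contraction P⟩
  · intro h
    refine hP.1 (P.one_mem_iff.1 ?_)
    rw [← map_one (C δ), ← mem_contraction, h]
    trivial
  · intro J K _ hK hJK
    by_contra! hcon
    obtain ⟨⟨a, haJ, ha⟩, ⟨b, hbK, hb⟩⟩ := hcon.imp SetLike.not_le_iff_exists.1
      SetLike.not_le_iff_exists.1
    refine (hP.2 (C δ a) (C δ b) fun f => ?_).elim ha hb
    induction f using induction_on with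
    | add f g hf hg => rw [mul_add, add_mul]; exact P.add_mem hf hg
    | monomial r i =>
      have h : ∀ i, ∀ s ∈ J, ∀ t ∈ K, C δ s * X δ ^ i * C δ t ∈ P := by
        intro i
        induction i with
        | zero =>
          intro s hs t ht
          rw [pow_zero, mul_one, ← map_mul, ← mem_contraction]
          exact hJK (Ideal.mul_mem_mul hs ht)
        | succ i ih =>
          intro s hs t ht
          have h : C δ s * X δ ^ (i + 1) * C δ t =
              C δ s * X δ ^ i * C δ t * X δ + C δ s * X δ ^ i * C δ (δ t) := by
            rw [pow_succ, mul_assoc, mul_assoc (X δ ^ i), X_mul_C]; noncomm_ring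
          rw [h]
          exact P.add_mem (P.mul_mem_right _ _ (ih s hs t ht)) (ih s hs _ (hK _ ht))
      rw [← mul_assoc, ← map_mul]
      exact h i _ (J.mul_mem_right _ haJ) _ hbK

theorem eq_sum_C_mul_X_pow (f : SkewPoly δ) :
    f = ∑ i ∈ Finset.range ((toPoly δ f).natDegree + 1), C δ ((toPoly δ f).coeff i) * X δ ^ i := by
  apply (toPoly δ).injective
  simp only [map_sum, toPoly_C_mul_X_pow]
  exact Polynomial.as_sum_range _

theorem mem_of_coeff_mem_contraction {P : TwoSidedIdeal (SkewPoly δ)} {f : SkewPoly δ}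
    (h : ∀ n, (toPoly δ f).coeff n ∈ contraction P) : f ∈ P := by
  rw [eq_sum_C_mul_X_pow f]
  exact sum_mem fun i _ => P.mul_mem_right _ _ (h i)

/-- Over a domain of characteristic zero with `δ ≠ 0`, nonzero ideals of `R[x;δ]` meet `R`: taking
commutators with an element of `R` not killed by `δ` lowers the degree of an element by one. -/
theorem exists_C_mem [CharZero k] [IsDomain R] (hδ : δ ≠ 0) (I : TwoSidedIdeal (SkewPoly δ))
    {f : SkewPoly δ} (hf : f ∈ I) (hf0 : f ≠ 0) : ∃ s, s ≠ 0 ∧ C δ s ∈ I := by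
  have : CharZero R := charZero_of_injective_algebraMap (algebraMap k R).injective
  obtain ⟨r, hr⟩ : ∃ r, δ r ≠ 0 := by
    by_contra! h
    exact hδ (Derivation.ext h)
  obtain ⟨n, hn⟩ : ∃ n, (toPoly δ f).natDegree = n := ⟨_, rfl⟩
  induction n generalizing f with
  | zero =>
    have h := eq_sum_C_mul_X_pow f
    rw [hn] at h
    simp only [zero_add, Finset.range_one, Finset.sum_singleton, pow_zero, mul_one] at h
    refine ⟨_, fun h0 => hf0 ?_, h ▸ hf⟩
    rw [h, h0, map_zero]
  | succ n ih =>
    obtain ⟨h1, h2⟩ := coeff_commutator_C δ f r hn.le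
    have h3 : (toPoly δ f).coeff (n + 1) ≠ 0 := by
      rw [← hn, Polynomial.coeff_natDegree, Polynomial.leadingCoeff_ne_zero]
      exact fun h => hf0 ((toPoly δ).map_eq_zero_iff.1 h)
    have h4 : (toPoly δ (f * C δ r - C δ r * f)).coeff n ≠ 0 := by
      rw [h2]
      exact mul_ne_zero (mul_ne_zero (Nat.cast_ne_zero.2 n.succ_ne_zero) h3) hr
    refine ih (f := f * C δ r - C δ r * f)
      (I.sub_mem (I.mul_mem_right _ _ hf) (I.mul_mem_left _ _ hf)) ?_ ?_
    · intro h
      rw [h, map_zero, Polynomial.coeff_zero] at h4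
      exact h4 rfl
    · exact le_antisymm (Polynomial.natDegree_le_iff_coeff_eq_zero.2 h1)
        (Polynomial.le_natDegree_of_ne_zero h4)

end Contraction

/-! ### Extension of prime `δ`-ideals -/

section Extension

variable {k : Type u} {R : Type v} [Field k] [CommRing R] [Algebra k R] {δ : Derivation k R R}
  {p : Ideal R} (hp : IsPrimeDeltaIdeal δ p)

/-- The projection `R[x;δ] → (R/p)[x;δ]`. -/
noncomputable def reduction : SkewPoly δ →ₐ[k] SkewPoly (quotientDeriv δ p hp) :=
  map (Ideal.Quotient.mkₐ k p) fun r => (quotientDeriv_mk δ p hp r).symm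

theorem reduction_C (r : R) :
    reduction hp (C δ r) = C (quotientDeriv δ p hp) (Ideal.Quotient.mk p r) := map_C _ _ r

theorem reduction_surjective : Function.Surjective (reduction hp) :=
  map_surjective _ _ (Ideal.Quotient.mkₐ_surjective k p)

theorem reduction_eq_zero_iff (f : SkewPoly δ) :
    reduction hp f = 0 ↔ ∀ n, (toPoly δ f).coeff n ∈ p :=
  (map_apply_eq_zero_iff _ _ f).trans (by simp [Ideal.Quotient.eq_zero_iff_mem])

/-- The extension `p R[x;δ]` of a prime `δ`-ideal `p`, as the kernel of the reduction modulo `p`: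
it consists of the skew polynomials with all coefficients in `p`. -/
noncomputable def extension : TwoSidedIdeal (SkewPoly δ) := TwoSidedIdeal.ker (reduction hp)

theorem mem_extension_iff (f : SkewPoly δ) : f ∈ extension hp ↔ reduction hp f = 0 :=
  TwoSidedIdeal.mem_ker _

theorem C_mem_extension_iff (r : R) : C δ r ∈ extension hp ↔ r ∈ p := by
  rw [mem_extension_iff, reduction_C, ← map_zero (C _), (C_injective _).eq_iff,
    Ideal.Quotient.eq_zero_iff_mem]

theorem isPrimeIdeal_extension : (extension hp).IsPrimeIdeal := by
  have := hp.isPrime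
  refine ⟨fun h => ?_, fun f g hfg => ?_⟩
  · have h1 : (1 : SkewPoly δ) ∈ extension hp := h ▸ trivial
    rw [mem_extension_iff, map_one] at h1
    exact one_ne_zero h1
  · have h1 := hfg 1
    simp only [mem_extension_iff, mul_one, map_mul] at h1 ⊢
    exact mul_eq_zero.1 h1

/-- A prime ideal `P` of `R[x;δ]` that does not contain `δ(R)` is the extension of `P ∩ R`. -/
theorem eq_extension_contraction [CharZero k] {P : TwoSidedIdeal (SkewPoly δ)}
    (hp : IsPrimeDeltaIdeal δ (contraction P)) (hδ : ∃ r, C δ (δ r) ∉ P) :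
    P = extension hp := by
  have := hp.isPrime
  have hle (f) (hf : reduction hp f = 0) : f ∈ P :=
    mem_of_coeff_mem_contraction ((reduction_eq_zero_iff hp f).1 hf)
  have hd : quotientDeriv δ (contraction P) hp ≠ 0 := by
    obtain ⟨r, hr⟩ := hδ
    intro h
    have h1 := quotientDeriv_mk δ (contraction P) hp r
    rw [h, Derivation.zero_apply, eq_comm, Ideal.Quotient.eq_zero_iff_mem] at h1
    exact hr h1
  let I : TwoSidedIdeal (SkewPoly (quotientDeriv δ (contraction P) hp)) :=
    TwoSidedIdeal.mk' {g | ∃ f ∈ P, reduction hp f = g} ⟨0, P.zero_mem, map_zero _⟩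
      (by rintro _ _ ⟨f, hf, rfl⟩ ⟨g, hg, rfl⟩; exact ⟨f + g, P.add_mem hf hg, map_add _ _ _⟩)
      (by rintro _ ⟨f, hf, rfl⟩; exact ⟨-f, P.neg_mem hf, map_neg _ _⟩)
      (by
        rintro g _ ⟨f, hf, rfl⟩
        obtain ⟨g, rfl⟩ := reduction_surjective hp g
        exact ⟨g * f, P.mul_mem_left _ _ hf, map_mul _ _ _⟩)
      (by
        rintro _ g ⟨f, hf, rfl⟩
        obtain ⟨g, rfl⟩ := reduction_surjective hp g
        exact ⟨f * g, P.mul_mem_right _ _ hf, map_mul _ _ _⟩)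
  refine TwoSidedIdeal.ext fun f => ⟨fun hf => ?_, fun hf => hle f ((mem_extension_iff hp f).1 hf)⟩
  rw [mem_extension_iff]
  by_contra hf0
  obtain ⟨s, hs, hsI⟩ := exists_C_mem hd I
    ((TwoSidedIdeal.mem_mk' _ _ _ _ _ _ _).2 ⟨f, hf, rfl⟩) hf0
  obtain ⟨g, hg, hgs⟩ := (TwoSidedIdeal.mem_mk' _ _ _ _ _ _ _).1 hsI
  obtain ⟨r, rfl⟩ := Ideal.Quotient.mk_surjective s
  rw [← reduction_C] at hgs
  have h1 := P.sub_mem hg (hle (g - C δ r) (by rw [map_sub, hgs, sub_self]))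
  rw [sub_sub_cancel] at h1
  exact hs (Ideal.Quotient.eq_zero_iff_mem.2 h1)

/-- Local closedness of `P` and of `P ∩ R` agree when `P` does not contain `δ(R)`: the prime ideals
above `P` contract to larger prime `δ`-ideals, and the prime `δ`-ideals above `P ∩ R` extend to
larger prime ideals. -/
theorem isLocallyClosedIdeal_iff [CharZero k] [IsNoetherianRing R]
    {P : TwoSidedIdeal (SkewPoly δ)} (hP : P.IsPrimeIdeal) (hδ : ∃ r, C δ (δ r) ∉ P) :
    P.IsLocallyClosedIdeal ↔ IsDeltaLocallyClosed δ (contraction P) := by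
  have hp := isPrimeDeltaIdeal_contraction hP
  have hPe (f) : f ∈ P ↔ ∀ n, (toPoly δ f).coeff n ∈ contraction P := by
    conv_lhs => rw [eq_extension_contraction hp hδ, mem_extension_iff, reduction_eq_zero_iff]
  constructor
  · intro h
    obtain ⟨f, hf, hfP⟩ := SetLike.exists_of_lt h
    rw [TwoSidedIdeal.mem_sInf] at hf
    rw [hPe] at hfP
    push Not at hfP
    obtain ⟨n, hn⟩ := hfP
    refine lt_of_le_of_ne (le_sInf fun q hq => hq.2.le) fun heq => hn ?_
    rw [heq, Submodule.mem_sInf]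
    intro q hq
    refine (reduction_eq_zero_iff hq.1 f).1 ((mem_extension_iff hq.1 f).1 (hf _ ?_)) n
    refine ⟨isPrimeIdeal_extension hq.1, lt_of_le_of_ne ?_ fun h => hq.2.ne ?_⟩
    · intro g hg
      rw [hPe] at hg
      rw [mem_extension_iff, reduction_eq_zero_iff]
      exact fun n => hq.2.le (hg n)
    · ext r
      rw [mem_contraction, h, C_mem_extension_iff]
  · intro h
    obtain ⟨r, hr, hrP⟩ := SetLike.exists_of_lt h
    rw [Submodule.mem_sInf] at hr
    refine lt_of_le_of_ne (le_sInf fun Q hQ => hQ.2.le) fun heq => hrP ?_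
    rw [mem_contraction, heq, TwoSidedIdeal.mem_sInf]
    intro Q hQ
    have hle : contraction P ≤ contraction Q := fun s hs => hQ.2.le hs
    have hq := isPrimeDeltaIdeal_contraction hQ.1
    refine hr _ ⟨hq, lt_of_le_of_ne hle fun hPQ => hQ.2.ne ?_⟩
    have hδQ : ∃ r, C δ (δ r) ∉ Q := by
      obtain ⟨s, hs⟩ := hδ
      exact ⟨s, fun hsQ => hs (mem_contraction.1 (hPQ ▸ mem_contraction.2 hsQ))⟩
    refine TwoSidedIdeal.ext fun f => ?_
    conv_lhs => rw [hPe, hPQ]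
    conv_rhs => rw [eq_extension_contraction hq hδQ, mem_extension_iff, reduction_eq_zero_iff]

end Extension

end SkewPoly

/-! ### Primitive ideals and `δ`-primitive ideals -/

/-- Annihilators of simple modules are prime. -/
theorem TwoSidedIdeal.isPrimeIdeal_annihilator {A M : Type*} [Ring A] [AddCommGroup M] [Module A M]
    [IsSimpleModule A M] : (Module.annihilator A M).toTwoSided.IsPrimeIdeal := by
  have := IsSimpleModule.nontrivial A M
  refine ⟨fun h => ?_, fun a b hab => ?_⟩
  · have h1 : (1 : A) ∈ (Module.annihilator A M).toTwoSided := h ▸ trivial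
    rw [Ideal.mem_toTwoSided, Module.mem_annihilator] at h1
    obtain ⟨m, hm⟩ := exists_ne (0 : M)
    exact hm (by simpa using h1 m)
  · simp only [Ideal.mem_toTwoSided, Module.mem_annihilator] at hab ⊢
    by_contra! h
    obtain ⟨⟨w, hw⟩, ⟨v, hv⟩⟩ := h
    obtain ⟨r, hr⟩ := IsSimpleModule.toSpanSingleton_surjective A hv w
    rw [LinearMap.toSpanSingleton_apply] at hr
    refine hw ?_
    rw [← hr, ← mul_smul, ← mul_smul]
    exact hab r v

namespace SkewPoly

section RightAction

variable {k : Type u} {R : Type v} [CommRing k] [CommRing R] [Algebra k R] (δ : Derivation k R R)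

/-- The image of `1` under the right action of `R[x;δ]` on `R` in which `R` acts by multiplication
and `x` by `-δ`: it sends `∑ aᵢ xⁱ` to `∑ (-δ)ⁱ(aᵢ)`. -/
noncomputable def rightAct : Polynomial R →ₗ[k] R :=
  Polynomial.lsum fun i => (-(δ : R →ₗ[k] R)) ^ i

variable {δ}

theorem rightAct_monomial (a : R) (i : ℕ) :
    rightAct δ (toPoly δ (C δ a * X δ ^ i)) = ((-(δ : R →ₗ[k] R)) ^ i) a := by
  rw [toPoly_C_mul_X_pow, rightAct, Polynomial.lsum_apply, Polynomial.sum_monomial_index]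
  exact map_zero _

theorem rightAct_one : rightAct δ (toPoly δ 1) = 1 := by
  have := rightAct_monomial (δ := δ) 1 0
  simpa using this

theorem rightAct_mul_X (f : SkewPoly δ) :
    rightAct δ (toPoly δ (f * X δ)) = -δ (rightAct δ (toPoly δ f)) := by
  induction f using induction_on with
  | add f g hf hg => rw [add_mul, map_add, map_add, hf, hg, map_add, map_add, map_add, neg_add]
  | monomial a i =>
    rw [mul_assoc, ← pow_succ, rightAct_monomial, rightAct_monomial, pow_succ']
    rfl

theorem rightAct_mul_C (f : SkewPoly δ) (r : R) :
    rightAct δ (toPoly δ (f * C δ r)) = rightAct δ (toPoly δ f) * r := by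
  induction f using induction_on with
  | add f g hf hg => rw [add_mul, map_add, map_add, hf, hg, map_add, map_add, add_mul]
  | monomial a i =>
    induction i generalizing r with
    | zero =>
      have h1 := rightAct_monomial (δ := δ) (a * r) 0
      have h2 := rightAct_monomial (δ := δ) a 0
      simp only [pow_zero, mul_one, Module.End.one_apply, map_mul] at h1 h2 ⊢
      rw [h1, h2]
    | succ i ih =>
      rw [pow_succ, ← mul_assoc, mul_assoc _ (X δ), X_mul_C, mul_add, ← mul_assoc, map_add, map_add,
        rightAct_mul_X, ih, ih, rightAct_mul_X, Derivation.leibniz, smul_eq_mul, smul_eq_mul]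
      ring

end RightAction

section Primitive

variable {k : Type u} {R : Type v} [Field k] [CommRing R] [Algebra k R] {δ : Derivation k R R}

/-- For a maximal ideal `m` of `R`, the left ideal `R[x;δ] m` is proper, because it acts on the
right on `R` with values in `m`. -/
theorem span_C_image_ne_top {m : Ideal R} (hm : m ≠ ⊤) :
    Ideal.span (C δ '' m) ≠ (⊤ : Ideal (SkewPoly δ)) := by
  intro h
  have key : ∀ f ∈ Ideal.span (C δ '' m), ∀ g, rightAct δ (toPoly δ (g * f)) ∈ m := by
    intro f hf
    induction hf using Submodule.span_induction with
    | mem f hf =>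
      obtain ⟨r, hr, rfl⟩ := hf
      intro g
      rw [rightAct_mul_C]
      exact m.mul_mem_left _ hr
    | zero => intro g; simp
    | add f f' _ _ hf hf' =>
      intro g
      rw [mul_add, map_add, map_add]
      exact m.add_mem (hf g) (hf' g)
    | smul a f _ hf =>
      intro g
      rw [smul_eq_mul, ← mul_assoc]
      exact hf _
  have h1 := key 1 (h ▸ Submodule.mem_top) 1
  rw [mul_one, rightAct_one] at h1
  exact hm ((Ideal.eq_top_iff_one m).2 h1)

/-- If `P ∩ R` is maximal among the prime `δ`-ideals inside a maximal ideal `m`, then `P` is the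
annihilator of any simple quotient of `R[x;δ] / R[x;δ] m`. -/
theorem isPrimitiveIdeal_of_isDeltaPrimitive [CharZero k] [IsNoetherianRing R]
    {P : TwoSidedIdeal (SkewPoly δ)} (hP : P.IsPrimeIdeal) (hδ : ∃ r, C δ (δ r) ∉ P)
    (h : IsDeltaPrimitive δ (contraction P)) : P.IsPrimitiveIdeal := by
  obtain ⟨m, hm, hmax⟩ := h
  have hp := isPrimeDeltaIdeal_contraction hP
  obtain ⟨L, hL, hmL⟩ := Ideal.exists_le_maximal _ (span_C_image_ne_top (δ := δ) hm.ne_top)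
  have hsimple : IsSimpleModule (SkewPoly δ) (SkewPoly δ ⧸ L) :=
    isSimpleModule_iff_isCoatom.2 hL.1
  have hpL : ∀ f : SkewPoly δ, ∀ r ∈ contraction P, C δ r * f ∈ L := by
    intro f
    induction f using induction_on with
    | add f g hf hg => intro r hr; rw [mul_add]; exact L.add_mem (hf r hr) (hg r hr)
    | monomial a i =>
      intro r hr
      rw [← mul_assoc, ← map_mul]
      replace hr := Ideal.mul_mem_right a _ hr
      generalize r * a = s at hr
      induction i generalizing s with
      | zero =>
        rw [pow_zero, mul_one]
        exact hmL (Ideal.subset_span ⟨s, hmax.1.2 hr, rfl⟩)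
      | succ i ih =>
        have h1 : C δ s * X δ ^ (i + 1) = X δ * (C δ s * X δ ^ i) - C δ (δ s) * X δ ^ i := by
          rw [← mul_assoc, X_mul_C, pow_succ']; noncomm_ring
        rw [h1]
        exact L.sub_mem (L.mul_mem_left _ (ih s hr)) (ih _ (hp.deriv_mem _ hr))
  set Q := (Module.annihilator (SkewPoly δ) (SkewPoly δ ⧸ L)).toTwoSided with hQdef
  have hQ : Q.IsPrimeIdeal := TwoSidedIdeal.isPrimeIdeal_annihilator
  have hq := isPrimeDeltaIdeal_contraction hQ
  have hQL : ∀ f ∈ Q, f ∈ L := by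
    intro f hf
    rw [Ideal.mem_toTwoSided, Module.mem_annihilator] at hf
    have h1 := hf (Submodule.Quotient.mk 1)
    rwa [← Submodule.Quotient.mk_smul, Submodule.Quotient.mk_eq_zero, smul_eq_mul, mul_one] at h1
  have hPQ : contraction P ≤ contraction Q := by
    intro r hr
    rw [mem_contraction, Ideal.mem_toTwoSided, Module.mem_annihilator]
    intro v
    obtain ⟨f, rfl⟩ := Submodule.Quotient.mk_surjective _ v
    rw [← Submodule.Quotient.mk_smul, Submodule.Quotient.mk_eq_zero]
    exact hpL f r hr
  have hQm : contraction Q ≤ m := by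
    have h1 : m = L.comap (C δ) := hm.eq_of_le (Ideal.comap_ne_top _ hL.ne_top)
      fun r hr => hmL (Ideal.subset_span ⟨r, hr, rfl⟩)
    intro r hr
    rw [h1]
    exact hQL _ hr
  have heq : contraction P = contraction Q := le_antisymm hPQ (hmax.2 ⟨hq, hQm⟩ hPQ)
  have hδQ : ∃ r, C δ (δ r) ∉ Q := by
    obtain ⟨s, hs⟩ := hδ
    exact ⟨s, fun hsQ => hs (mem_contraction.1 (heq ▸ mem_contraction.2 hsQ))⟩
  have hPeqQ : P = Q := by
    refine TwoSidedIdeal.ext fun f => ?_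
    conv_lhs => rw [eq_extension_contraction hp hδ, mem_extension_iff, reduction_eq_zero_iff, heq]
    conv_rhs => rw [eq_extension_contraction hq hδQ, mem_extension_iff, reduction_eq_zero_iff]
  refine ⟨SkewPoly δ ⧸ L, inferInstance, inferInstance, hsimple, ?_⟩
  ext f
  rw [TwoSidedIdeal.mem_asIdeal, hPeqQ, hQdef, Ideal.mem_toTwoSided]

end Primitive

section Filtration

variable {k : Type u} {R : Type v} [CommRing k] [CommRing R] [Algebra k R] {δ : Derivation k R R}
  {M : Type*} [AddCommGroup M] [Module (SkewPoly δ) M] (v : M)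

/-- The subgroup `∑_{i < n} xⁱ J v` of an `R[x;δ]`-module, for an ideal `J` of `R` and an
element `v` of the module. -/
def filtration (J : Ideal R) (n : ℕ) : AddSubgroup M :=
  AddSubgroup.closure {w | ∃ i < n, ∃ j ∈ J, w = X δ ^ i • C δ j • v}

variable {v} {J : Ideal R}

theorem smul_mem_filtration {i n : ℕ} (hi : i < n) {j : R} (hj : j ∈ J) :
    X δ ^ i • C δ j • v ∈ filtration (δ := δ) v J n :=
  AddSubgroup.subset_closure ⟨i, hi, j, hj, rfl⟩

theorem filtration_mono {I J : Ideal R} (hIJ : I ≤ J) {m n : ℕ} (h : m ≤ n) :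
    filtration (δ := δ) v I m ≤ filtration (δ := δ) v J n :=
  AddSubgroup.closure_mono fun _ ⟨i, hi, j, hj, hw⟩ => ⟨i, hi.trans_le h, j, hIJ hj, hw⟩

theorem filtration_zero : filtration (δ := δ) v J 0 = ⊥ := by simp [filtration]

theorem X_smul_mem_filtration {n : ℕ} {w : M} (hw : w ∈ filtration (δ := δ) v J n) :
    X δ • w ∈ filtration (δ := δ) v J (n + 1) := by
  induction hw using AddSubgroup.closure_induction with
  | mem w hw =>
    obtain ⟨i, hi, j, hj, rfl⟩ := hw
    rw [← mul_smul, ← pow_succ']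
    exact smul_mem_filtration (Nat.succ_lt_succ hi) hj
  | zero => rw [smul_zero]; exact zero_mem _
  | add w w' _ _ hw hw' => rw [smul_add]; exact add_mem hw hw'
  | neg w _ hw => rw [smul_neg]; exact neg_mem hw

/-- An element of `R` moves past `xⁱ` up to terms with lower powers of `x`. -/
theorem C_smul_sub_mem_filtration (hJ : ∀ r ∈ J, δ r ∈ J) (i : ℕ) {r u : R} (h : r ∈ J ∨ u ∈ J) :
    C δ r • X δ ^ i • C δ u • v - X δ ^ i • C δ (r * u) • v ∈ filtration (δ := δ) v J i := by
  induction i generalizing r with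
  | zero => simp [mul_smul]
  | succ i ih =>
    have h1 : C δ r * X δ ^ (i + 1) = X δ * (C δ r * X δ ^ i) - C δ (δ r) * X δ ^ i := by
      rw [← mul_assoc, X_mul_C, pow_succ']; noncomm_ring
    have h2 : C δ r • X δ ^ (i + 1) • C δ u • v - X δ ^ (i + 1) • C δ (r * u) • v =
        X δ • (C δ r • X δ ^ i • C δ u • v - X δ ^ i • C δ (r * u) • v) -
          ((C δ (δ r) • X δ ^ i • C δ u • v - X δ ^ i • C δ (δ r * u) • v) +
            X δ ^ i • C δ (δ r * u) • v) := by
      rw [← mul_smul (C δ r), h1, sub_smul, smul_sub, pow_succ']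
      simp only [mul_smul]
      abel
    have h3 : δ r ∈ J ∨ u ∈ J := h.imp_left (hJ r)
    rw [h2]
    refine sub_mem (X_smul_mem_filtration (ih h)) (add_mem ?_ ?_)
    · exact filtration_mono le_rfl i.le_succ (ih h3)
    · exact smul_mem_filtration i.lt_succ_self
        (h3.elim (fun h => J.mul_mem_right _ h) fun h => J.mul_mem_left _ h)

theorem C_smul_mem_filtration (hJ : ∀ r ∈ J, δ r ∈ J) {n : ℕ} (r : R) {w : M}
    (hw : w ∈ filtration (δ := δ) v J n) : C δ r • w ∈ filtration (δ := δ) v J n := by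
  induction hw using AddSubgroup.closure_induction with
  | mem w hw =>
    obtain ⟨i, hi, j, hj, rfl⟩ := hw
    have h1 := filtration_mono le_rfl hi.le
      (C_smul_sub_mem_filtration (v := v) hJ i (r := r) (Or.inr hj))
    have h2 := smul_mem_filtration (v := v) (δ := δ) hi (J.mul_mem_left r hj)
    simpa using add_mem h1 h2
  | zero => rw [smul_zero]; exact zero_mem _
  | add w w' _ _ hw hw' => rw [smul_add]; exact add_mem hw hw'
  | neg w _ hw => rw [smul_neg]; exact neg_mem hw

theorem C_smul_mem_filtration_of_mem (hJ : ∀ r ∈ J, δ r ∈ J) {n : ℕ} {j : R} (hj : j ∈ J) {w : M}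
    (hw : w ∈ filtration (δ := δ) v ⊤ n) : C δ j • w ∈ filtration (δ := δ) v J n := by
  induction hw using AddSubgroup.closure_induction with
  | mem w hw =>
    obtain ⟨i, hi, u, -, rfl⟩ := hw
    have h1 := filtration_mono le_rfl hi.le
      (C_smul_sub_mem_filtration (v := v) hJ i (u := u) (Or.inl hj))
    have h2 := smul_mem_filtration (v := v) (δ := δ) hi (J.mul_mem_right u hj)
    simpa using add_mem h1 h2
  | zero => rw [smul_zero]; exact zero_mem _
  | add w w' _ _ hw hw' => rw [smul_add]; exact add_mem hw hw'
  | neg w _ hw => rw [smul_neg]; exact neg_mem hw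

/-- If `xⁿ f v` lies in `∑_{i < n} xⁱ R v`, then `f` maps `∑_{i ≤ n} xⁱ J v` to
`∑_{i < n} xⁱ J v`. -/
theorem C_smul_mem_filtration_of_le (hJ : ∀ r ∈ J, δ r ∈ J) {n : ℕ} {f : R}
    (hf : X δ ^ n • C δ f • v ∈ filtration (δ := δ) v ⊤ n) {w : M}
    (hw : w ∈ filtration (δ := δ) v J (n + 1)) : C δ f • w ∈ filtration (δ := δ) v J n := by
  induction hw using AddSubgroup.closure_induction with
  | mem w hw =>
    obtain ⟨i, hi, j, hj, rfl⟩ := hw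
    rcases (Nat.lt_succ_iff.1 hi).lt_or_eq with h | rfl
    · exact C_smul_mem_filtration hJ f (smul_mem_filtration h hj)
    · -- both `f xⁿ j v` and `j xⁿ f v` agree with `xⁿ f j v` up to lower terms
      have h1 := C_smul_sub_mem_filtration (v := v) hJ i (r := f) (Or.inr hj)
      have h2 := C_smul_sub_mem_filtration (v := v) hJ i (u := f) (Or.inl hj)
      have h3 := C_smul_mem_filtration_of_mem hJ hj hf
      have h4 := add_mem (sub_mem h1 h2) h3
      rw [mul_comm j f] at h4
      convert h4 using 1
      abel
  | zero => rw [smul_zero]; exact zero_mem _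
  | add w w' _ _ hw hw' => rw [smul_add]; exact add_mem hw hw'
  | neg w _ hw => rw [smul_neg]; exact neg_mem hw

theorem exists_of_mem_filtration_succ {n : ℕ} {w : M}
    (hw : w ∈ filtration (δ := δ) v J (n + 1)) :
    ∃ w' ∈ filtration (δ := δ) v J n, ∃ j ∈ J, w = w' + X δ ^ n • C δ j • v := by
  induction hw using AddSubgroup.closure_induction with
  | mem w hw =>
    obtain ⟨i, hi, j, hj, rfl⟩ := hw
    rcases (Nat.lt_succ_iff.1 hi).lt_or_eq with h | rfl
    · exact ⟨_, smul_mem_filtration h hj, 0, J.zero_mem, by simp⟩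
    · exact ⟨0, zero_mem _, j, hj, by simp⟩
  | zero => exact ⟨0, zero_mem _, 0, J.zero_mem, by simp⟩
  | add w w' _ _ hw hw' =>
    obtain ⟨a, ha, j, hj, rfl⟩ := hw
    obtain ⟨a', ha', j', hj', rfl⟩ := hw'
    refine ⟨_, add_mem ha ha', _, J.add_mem hj hj', ?_⟩
    rw [map_add, add_smul, smul_add]; abel
  | neg w _ hw =>
    obtain ⟨a, ha, j, hj, rfl⟩ := hw
    refine ⟨_, neg_mem ha, _, J.neg_mem hj, ?_⟩
    rw [map_neg, neg_smul, smul_neg]; abel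

/-- As long as the quotients of consecutive terms of the filtration by `∑_{i < n} xⁱ R v` are
isomorphic to `R / q`, an equality `g v = ∑ xⁱ jᵢ v` reduces to `g v = j₀ v`. -/
theorem exists_sub_mem_of_mem_filtration {q : Ideal R} (hq : ∀ r, r ∈ q ↔ C δ r • v = 0) {N : ℕ}
    (hN : ∀ n < N, ∀ r, X δ ^ n • C δ r • v ∈ filtration (δ := δ) v ⊤ n → r ∈ q) {n : ℕ}
    (hn : n ≤ N) {g : R} (hg : C δ g • v ∈ filtration (δ := δ) v J n) :
    ∃ j ∈ J, g - j ∈ q := by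
  induction n with
  | zero =>
    rw [filtration_zero, AddSubgroup.mem_bot] at hg
    exact ⟨0, J.zero_mem, by rw [sub_zero, hq, hg]⟩
  | succ n ih =>
    obtain ⟨w, hw, j, hj, hgw⟩ := exists_of_mem_filtration_succ hg
    cases n with
    | zero =>
      rw [filtration_zero, AddSubgroup.mem_bot] at hw
      refine ⟨j, hj, ?_⟩
      rw [hq, map_sub, sub_smul, hgw, hw]
      simp
    | succ n =>
      have hj0 : j ∈ q := by
        refine hN (n + 1) (by lia) j ?_
        have h1 : C δ g • v ∈ filtration (δ := δ) v ⊤ (n + 1) := by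
          simpa using smul_mem_filtration (δ := δ) (v := v) n.succ_pos (Submodule.mem_top (x := g))
        have h2 := sub_mem h1 (filtration_mono le_top le_rfl hw)
        rwa [hgw, add_sub_cancel_left] at h2
      rw [(hq j).1 hj0, smul_zero, add_zero] at hgw
      exact ih (by lia) (hgw ▸ hw)

/-- A form of generic flatness for the cyclic module `R[x;δ] v`: after inverting a suitable
`f` outside of the annihilator `q` of `v`, the filtration by `∑_{i < n} xⁱ R v` has quotients `R / q`
up to some point and is constant from there on. -/
theorem exists_notMem_forall_mem_filtration {q : Ideal R} (hq1 : q ≠ ⊤)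
    (hq : ∀ r, r ∈ q ↔ C δ r • v = 0) :
    ∃ f ∉ q, ∀ J : Ideal R, (∀ r ∈ J, δ r ∈ J) → ∀ n, v ∈ filtration (δ := δ) v J n →
      ∃ e : ℕ, ∃ j ∈ J, f ^ e - j ∈ q := by
  classical
  by_cases hex : ∃ n, ∃ f, X δ ^ n • C δ f • v ∈ filtration (δ := δ) v ⊤ n ∧ f ∉ q
  · obtain ⟨f, hf, hfq⟩ := Nat.find_spec hex
    set N := Nat.find hex
    have hN : ∀ n < N, ∀ r, X δ ^ n • C δ r • v ∈ filtration (δ := δ) v ⊤ n → r ∈ q := by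
      intro n hn r hr
      by_contra hrq
      exact Nat.find_min hex hn ⟨r, hr, hrq⟩
    have hfe : ∀ e, X δ ^ (N + e) • C δ f • v ∈ filtration (δ := δ) v ⊤ (N + e) := by
      intro e
      induction e with
      | zero => exact hf
      | succ e ih =>
        rw [← add_assoc, pow_succ', mul_smul]
        exact X_smul_mem_filtration ih
    refine ⟨f, hfq, fun J hJ n hn => ⟨n, ?_⟩⟩
    have h1 : ∀ e, ∀ w ∈ filtration (δ := δ) v J (N + e),
        C δ (f ^ e) • w ∈ filtration (δ := δ) v J N := by
      intro e
      induction e with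
      | zero => simp
      | succ e ih =>
        intro w hw
        rw [pow_succ, map_mul, mul_smul]
        exact ih _ (C_smul_mem_filtration_of_le hJ (hfe e) hw)
    exact exists_sub_mem_of_mem_filtration hq hN le_rfl
      (h1 n v (filtration_mono le_rfl (Nat.le_add_left n N) hn))
  · push Not at hex
    refine ⟨1, fun h => hq1 ((Ideal.eq_top_iff_one q).2 h), fun J hJ n hn => ⟨0, ?_⟩⟩
    exact exists_sub_mem_of_mem_filtration hq (fun n _ r hr => hex n r hr) le_rfl (n := n)
      (by simpa using hn)

theorem exists_mem_filtration_of_mem_span (hJ : ∀ r ∈ J, δ r ∈ J) {w : M}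
    (hw : w ∈ Submodule.span (SkewPoly δ) {w | ∃ j ∈ J, w = C δ j • v}) :
    ∃ n, w ∈ filtration (δ := δ) v J n := by
  induction hw using Submodule.span_induction with
  | mem w hw =>
    obtain ⟨j, hj, rfl⟩ := hw
    exact ⟨1, by simpa using smul_mem_filtration (δ := δ) (v := v) one_pos hj⟩
  | zero => exact ⟨0, zero_mem _⟩
  | add w w' _ _ hw hw' =>
    obtain ⟨n, hn⟩ := hw
    obtain ⟨n', hn'⟩ := hw'
    exact ⟨n + n', add_mem (filtration_mono le_rfl (Nat.le_add_right _ _) hn)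
      (filtration_mono le_rfl (Nat.le_add_left _ _) hn')⟩
  | smul a w _ hw =>
    obtain ⟨n, hn⟩ := hw
    induction a using induction_on with
    | add f g hf hg =>
      obtain ⟨m, hm⟩ := hf
      obtain ⟨m', hm'⟩ := hg
      rw [add_smul]
      exact ⟨m + m', add_mem (filtration_mono le_rfl (Nat.le_add_right _ _) hm)
        (filtration_mono le_rfl (Nat.le_add_left _ _) hm')⟩
    | monomial r i =>
      refine ⟨n + i, ?_⟩
      rw [mul_smul]
      refine C_smul_mem_filtration hJ r ?_
      induction i with
      | zero => simpa using hn
      | succ i ih => rw [pow_succ', mul_smul]; exact X_smul_mem_filtration ih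

/-- The elements of an `R[x;δ]`-module killed by a `δ`-stable ideal of `R` form a submodule, so in a
simple module the ideal kills everything as soon as it kills some `v ≠ 0`. -/
theorem C_smul_eq_zero_of_forall [IsSimpleModule (SkewPoly δ) M] (hJ : ∀ r ∈ J, δ r ∈ J)
    (hv : v ≠ 0) (h : ∀ j ∈ J, C δ j • v = 0) {j : R} (hj : j ∈ J) (w : M) : C δ j • w = 0 := by
  obtain ⟨f, rfl⟩ := IsSimpleModule.toSpanSingleton_surjective (SkewPoly δ) hv w
  rw [LinearMap.toSpanSingleton_apply]
  induction f using induction_on with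
  | add f g hf hg => rw [add_smul, smul_add, hf, hg, add_zero]
  | monomial r i =>
    rw [mul_smul, ← mul_smul, ← map_mul]
    replace hj := J.mul_mem_right r hj
    generalize j * r = s at hj
    induction i generalizing s with
    | zero => simpa using h s hj
    | succ i ih =>
      have h1 : C δ s * X δ ^ (i + 1) = X δ * (C δ s * X δ ^ i) - C δ (δ s) * X δ ^ i := by
        rw [← mul_assoc, X_mul_C, pow_succ']; noncomm_ring
      rw [← mul_smul, h1, sub_smul, mul_smul, mul_smul, mul_smul, ih s hj, ih _ (hJ s hj),
        smul_zero, sub_zero]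

end Filtration

section Primitive

variable {k : Type u} {R : Type v} [Field k] [CommRing R] [Algebra k R] {δ : Derivation k R R}

theorem exists_annihilator_isPrime [IsNoetherianRing R] (M : Type*) [AddCommGroup M]
    [Module (SkewPoly δ) M] [Nontrivial M] :
    ∃ (v : M) (q : Ideal R), v ≠ 0 ∧ q.IsPrime ∧ ∀ r, r ∈ q ↔ C δ r • v = 0 := by
  let _ : Module R M := Module.compHom M (C δ)
  obtain ⟨w, hw⟩ := exists_ne (0 : M)
  obtain ⟨q, hq, -⟩ := exists_le_isAssociatedPrime_of_isNoetherianRing R w hw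
  obtain ⟨hprime, v, hv⟩ := (isAssociatedPrime_iff).1 hq
  have h : ∀ r, r ∈ q ↔ C δ r • v = 0 := fun r => by
    rw [hv, Submodule.mem_colon_singleton, Submodule.mem_bot]; rfl
  refine ⟨v, q, ?_, hprime, h⟩
  rintro rfl
  exact hprime.ne_top ((Ideal.eq_top_iff_one q).2 ((h 1).2 (smul_zero _)))

/-- If `P` is the annihilator of a simple module `M`, let `q` be the annihilator in `R`, prime, of
some `v ∈ M`, and let `f ∉ q` be as in generic flatness. A maximal ideal `m ⊇ q` of `R` with `f ∉ m`
exists since `R` is a Jacobson ring. If a prime `δ`-ideal `J ⊆ m` were larger than `P ∩ R`, then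
`R[x;δ] J v = M` would contain `v`, whence a power of `f` would lie in `J + q ⊆ m`. -/
theorem isDeltaPrimitive_of_isPrimitiveIdeal [CharZero k] [IsNoetherianRing R] [IsJacobsonRing R]
    {P : TwoSidedIdeal (SkewPoly δ)} (hP : P.IsPrimeIdeal) (h : P.IsPrimitiveIdeal) :
    IsDeltaPrimitive δ (contraction P) := by
  obtain ⟨M, _, _, hM, hann⟩ := h
  have := IsSimpleModule.nontrivial (SkewPoly δ) M
  have hmem (r : R) : r ∈ contraction P ↔ ∀ w : M, C δ r • w = 0 := by
    rw [mem_contraction, ← TwoSidedIdeal.mem_asIdeal, hann, Module.mem_annihilator]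
  obtain ⟨v, q, hv, hqprime, hq⟩ := exists_annihilator_isPrime (δ := δ) M
  obtain ⟨f, hfq, hf⟩ := exists_notMem_forall_mem_filtration hqprime.ne_top hq
  obtain ⟨m, hqm, hm, hfm⟩ : ∃ m, q ≤ m ∧ m.IsMaximal ∧ f ∉ m := by
    by_contra! hcon
    refine hfq ?_
    rw [← IsJacobsonRing.out inferInstance hqprime.isRadical, Ideal.jacobson, Submodule.mem_sInf]
    exact fun m hm => hcon m hm.1 hm.2
  refine ⟨m, hm, ⟨isPrimeDeltaIdeal_contraction hP, fun r hr => hqm ?_⟩, ?_⟩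
  · exact (hq r).2 ((hmem r).1 hr v)
  · rintro J ⟨hJ, hJm⟩ -
    have h1 : Submodule.span (SkewPoly δ) {w | ∃ j ∈ J, w = C δ j • v} = ⊥ := by
      refine (eq_bot_or_eq_top _).resolve_right fun htop => hfm ?_
      obtain ⟨n, hn⟩ := exists_mem_filtration_of_mem_span hJ.deriv_mem
        (htop ▸ Submodule.mem_top : v ∈ _)
      obtain ⟨e, j, hj, he⟩ := hf J hJ.deriv_mem n hn
      refine hm.isPrime.mem_of_pow_mem e ?_
      have h2 := m.add_mem (hqm he) (hJm hj)
      rwa [sub_add_cancel] at h2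
    intro j hj
    rw [hmem]
    refine C_smul_eq_zero_of_forall hJ.deriv_mem hv (fun j hj => ?_) hj
    rw [Submodule.span_eq_bot] at h1
    exact h1 _ ⟨j, hj, rfl⟩

end Primitive

end SkewPoly

/-! ### Ore sets and Ore localizations of domains -/

section OreDomain

/-- The centre of an algebra in which all nonzero elements are invertible is a field. -/
theorem isField_center_of_forall_exists_inverse {k D : Type*} [CommRing k] [Ring D] [Algebra k D]
    [Nontrivial D] (h : ∀ z : D, z ≠ 0 → ∃ w, z * w = 1 ∧ w * z = 1) :
    IsField (Subalgebra.center k D) where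
  exists_pair_ne := exists_pair_ne _
  mul_comm a b := mul_comm a b
  mul_inv_cancel {a} ha := by
    obtain ⟨w, hw1, hw2⟩ := h a fun h0 => ha (Subtype.ext h0)
    refine ⟨⟨w, Subalgebra.mem_center_iff.2 fun b => ?_⟩, Subtype.ext hw1⟩
    have hc := Subalgebra.mem_center_iff.1 a.2 b
    calc b * w = w * a * b * w := by rw [hw2, one_mul]
      _ = w * b := by rw [mul_assoc w, ← hc, mul_assoc, mul_assoc, hw1, mul_one]

variable {k B : Type*} [CommRing k] [Ring B] [Algebra k B] [OreLocalization.OreSet B⁰]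

variable (k B) in
/-- The inclusion of a ring in its Ore localization at the regular elements. -/
noncomputable def oreInclusion : B →ₐ[k] OreLocalization B⁰ B where
  __ := OreLocalization.numeratorRingHom
  commutes' _ := rfl

variable (k) in
theorem oreInclusion_injective :
    Function.Injective (oreInclusion k B) :=
  OreLocalization.numeratorHom_inj fun _ h => h.1

variable (k) in
theorem exists_oreInclusion_mul_eq (z : OreLocalization B⁰ B) :
    ∃ (s : B⁰) (b : B), oreInclusion k B (s : B) * z = oreInclusion k B b := by
  induction z using OreLocalization.ind with
  | _ r s => exact ⟨s, r, OreLocalization.mul_cancel⟩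

variable (k) in
theorem isUnit_oreInclusion (s : B⁰) :
    IsUnit (oreInclusion k B (s : B) : OreLocalization B⁰ B) :=
  OreLocalization.numerator_isUnit s

/-- An element of the Ore localization that commutes with all numerators is central. -/
theorem mem_center_of_forall_commute {z : OreLocalization B⁰ B}
    (h : ∀ b : B, oreInclusion k B b * z = z * oreInclusion k B b) :
    z ∈ Subalgebra.center k (OreLocalization B⁰ B) := by
  rw [Subalgebra.mem_center_iff]
  intro w
  obtain ⟨s, b, hw⟩ := exists_oreInclusion_mul_eq k w
  refine (isUnit_oreInclusion k s).mul_left_cancel ?_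
  rw [← mul_assoc, hw, ← mul_assoc, h, h, mul_assoc, hw]

theorem isField_center_oreLocalization [Nontrivial B] [NoZeroDivisors B] :
    IsField (Subalgebra.center k (OreLocalization B⁰ B)) :=
  isField_center_of_forall_exists_inverse fun z hz =>
    ⟨z⁻¹, mul_inv_cancel₀ hz, inv_mul_cancel₀ hz⟩

end OreDomain

namespace SkewPoly

section Ore

variable {k : Type u} {S : Type v} [CommRing k] [CommRing S] [IsDomain S] [Algebra k S]
  (d : Derivation k S S)

/-- The left Ore condition for skew polynomials over a domain: for `deg f ≤ m` and `deg g ≤ n`,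
the coefficients of `u f - w g` are `m + n + 1` linear forms in the `m + n + 2` coefficients of
multipliers `u` of degree at most `n` and `w` of degree at most `m`. -/
theorem exists_mul_eq_mul (f : SkewPoly d) {g : SkewPoly d} (hg : g ≠ 0) :
    ∃ u w : SkewPoly d, u ≠ 0 ∧ u * f = w * g := by
  set m := (toPoly d f).natDegree with hm
  set n := (toPoly d g).natDegree with hn
  let E₁ := Polynomial.degreeLTEquiv S (n + 1)
  let E₂ := Polynomial.degreeLTEquiv S (m + 1)
  let Φ : ((Fin (n + 1) → S) × (Fin (m + 1) → S)) →ₗ[S] (Fin (m + n + 1) → S) :=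
    { toFun x j := (mulLeft d (E₁.symm x.1 : Polynomial S) (toPoly d f) -
        mulLeft d (E₂.symm x.2 : Polynomial S) (toPoly d g)).coeff j
      map_add' x y := by
        ext j
        simp only [Prod.fst_add, Prod.snd_add, map_add, Submodule.coe_add, LinearMap.add_apply,
          Polynomial.coeff_sub, Polynomial.coeff_add, Pi.add_apply]
        ring
      map_smul' c x := by
        ext j
        simp only [Prod.smul_fst, Prod.smul_snd, map_smul, Submodule.coe_smul,
          Polynomial.smul_eq_C_mul, mulLeft_C_mul, Module.End.mul_apply, LinearMap.mulLeft_apply,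
          Polynomial.coeff_sub, Polynomial.coeff_C_mul, RingHom.id_apply, Pi.smul_apply,
          smul_eq_mul]
        ring }
  have hΦ : ¬ Function.Injective Φ := by
    intro h
    have := LinearMap.finrank_le_finrank_of_injective h
    simp only [Module.finrank_prod, Module.finrank_fin_fun] at this
    lia
  obtain ⟨x, hx, hx0⟩ : ∃ x, Φ x = 0 ∧ x ≠ 0 := by
    by_contra! hcon
    exact hΦ ((injective_iff_map_eq_zero Φ).2 hcon)
  let u : SkewPoly d := (toPoly d).symm (E₁.symm x.1 : Polynomial S)
  let w : SkewPoly d := (toPoly d).symm (E₂.symm x.2 : Polynomial S)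
  have hdeg {l : ℕ} (p : Polynomial.degreeLT S (l + 1)) : (p : Polynomial S).natDegree ≤ l :=
    Polynomial.natDegree_le_iff_coeff_eq_zero.2 fun j hj => Polynomial.coeff_eq_zero_of_degree_lt
      ((Polynomial.mem_degreeLT.1 p.2).trans_le (by exact_mod_cast hj))
  have hu : (toPoly d u).natDegree ≤ n := hdeg (E₁.symm x.1)
  have hw : (toPoly d w).natDegree ≤ m := hdeg (E₂.symm x.2)
  have heq : u * f = w * g := by
    refine ext_coeff fun j => ?_
    rcases lt_or_ge j (m + n + 1) with hj | hj
    · have := congrFun hx ⟨j, hj⟩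
      exact sub_eq_zero.1 ((Polynomial.coeff_sub _ _ _).symm.trans this)
    · rw [Polynomial.coeff_eq_zero_of_natDegree_lt, Polynomial.coeff_eq_zero_of_natDegree_lt]
      · have := natDegree_mul_le d w g; lia
      · have := natDegree_mul_le d u f; lia
  refine ⟨u, w, fun hu0 => hx0 ?_, heq⟩
  have hw0 : w = 0 := by
    rw [hu0, zero_mul, eq_comm] at heq
    exact (mul_eq_zero.1 heq).resolve_right hg
  have h1 : (E₁.symm x.1 : Polynomial S) = 0 := (toPoly d).symm.map_eq_zero_iff.1 hu0
  have h2 : (E₂.symm x.2 : Polynomial S) = 0 := (toPoly d).symm.map_eq_zero_iff.1 hw0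
  rw [ZeroMemClass.coe_eq_zero, LinearEquiv.map_eq_zero_iff] at h1 h2
  exact Prod.ext h1 h2

end Ore

/-! ### The centre of the field of fractions of a skew polynomial ring -/

section Centre

variable {k : Type u} {S B : Type v} [Field k] [CommRing S] [IsDomain S] [Algebra k S]
  {d : Derivation k S S} [Ring B] [Algebra k B] (e : SkewPoly d ≃ₐ[k] B)

theorem nonempty_oreSet (e : SkewPoly d ≃ₐ[k] B) [NoZeroDivisors B] [Nontrivial B] :
    Nonempty (OreLocalization.OreSet B⁰) := by
  rw [OreLocalization.nonempty_oreSet_iff_of_noZeroDivisors]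
  intro r s
  have hs : e.symm s ≠ 0 := fun h =>
    nonZeroDivisors.coe_ne_zero s ((map_eq_zero_iff e.symm e.symm.injective).1 h)
  obtain ⟨u, w, hu, huw⟩ := exists_mul_eq_mul d (e.symm r) hs
  refine ⟨e w, ⟨e u, mem_nonZeroDivisors_of_ne_zero fun h => hu ?_⟩, ?_⟩
  · exact (map_eq_zero_iff e e.injective).1 h
  · simpa using congrArg e huw

variable [OreLocalization.OreSet B⁰]

theorem isUnit_oreInclusion_C [NoZeroDivisors B] [Nontrivial B] (s : S⁰) :
    IsUnit (oreInclusion k B (e (C d s)) : OreLocalization B⁰ B) := by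
  refine isUnit_oreInclusion k ⟨e (C d s), mem_nonZeroDivisors_of_ne_zero fun h => ?_⟩
  rw [map_eq_zero_iff e e.injective, ← map_zero (C d), (C_injective d).eq_iff] at h
  exact nonZeroDivisors.coe_ne_zero s h

variable [NoZeroDivisors B] [Nontrivial B]

/-- The embedding of the field of fractions of `S` in the division ring of fractions of a ring `B`
isomorphic to `S[x;d]`. -/
noncomputable def fracEmb : FractionRing S →ₐ[k] OreLocalization B⁰ B where
  __ := OreLocalization.universalHom
    ((oreInclusion k B : B →+* OreLocalization B⁰ B).comp
      ((e : SkewPoly d →+* B).comp (C d)))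
    (IsUnit.liftRight
      (((oreInclusion k B : B →+* OreLocalization B⁰ B).comp
        ((e : SkewPoly d →+* B).comp (C d)) : S →* OreLocalization B⁰ B).comp S⁰.subtype)
      (isUnit_oreInclusion_C e))
    fun _ => rfl
  commutes' c := by
    rw [IsScalarTower.algebraMap_apply k S (FractionRing S)]
    refine (OreLocalization.universalHom_commutes _ _ _).trans ?_
    change oreInclusion k B (e (C d (algebraMap k S c))) = _
    rw [← algebraMap_eq, AlgEquiv.commutes, AlgHom.commutes]

theorem fracEmb_algebraMap (s : S) :
    fracEmb e (algebraMap S (FractionRing S) s) = oreInclusion k B (e (C d s)) :=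
  OreLocalization.universalHom_commutes _ _ _

/-- The relation `x f = f x + d f` for fractions `f` of elements of `S`. -/
theorem X_mul_fracEmb (f : FractionRing S) :
    oreInclusion k B (e (X d)) * fracEmb e f =
      fracEmb e f * oreInclusion k B (e (X d)) + fracEmb e (fracDeriv d f) := by
  have hS (s : S) : oreInclusion k B (e (X d)) * fracEmb e (algebraMap S (FractionRing S) s) =
      fracEmb e (algebraMap S (FractionRing S) s) * oreInclusion k B (e (X d)) +
        fracEmb e (fracDeriv d (algebraMap S (FractionRing S) s)) := by
    rw [fracDeriv_algebraMap, fracEmb_algebraMap, fracEmb_algebraMap]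
    simp only [← map_mul, ← map_add, X_mul_C]
  obtain ⟨a, b, hb, rfl⟩ := IsFractionRing.div_surjective (A := S) f
  set b' := algebraMap S (FractionRing S) b with hb'
  set f := algebraMap S (FractionRing S) a / b' with hf
  have hb0 : b' ≠ 0 := by simpa [hb'] using nonZeroDivisors.ne_zero hb
  have hfb : f * b' = algebraMap S (FractionRing S) a := div_mul_cancel₀ _ hb0
  have ha := hS a
  rw [← hfb, Derivation.leibniz, map_mul, map_add, smul_eq_mul, smul_eq_mul, map_mul, map_mul,
    mul_assoc _ _ (oreInclusion k B (e (X d))), ← sub_eq_of_eq_add (hS b)] at ha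
  have hu : IsUnit (fracEmb e b') := (IsUnit.mk0 b' hb0).map (fracEmb e)
  refine hu.mul_right_cancel ?_
  have hcomm : fracEmb e (fracDeriv d f) * fracEmb e b' =
      fracEmb e b' * fracEmb e (fracDeriv d f) := by rw [← map_mul, ← map_mul, mul_comm]
  rw [mul_assoc, ha, add_mul, hcomm]
  noncomm_ring

theorem fracEmb_mem_center {f : FractionRing S} (hf : fracDeriv d f = 0) :
    fracEmb e f ∈ Subalgebra.center k (OreLocalization B⁰ B) := by
  refine mem_center_of_forall_commute fun b => ?_
  obtain ⟨g, rfl⟩ := e.surjective b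
  have hX := X_mul_fracEmb e f
  rw [hf, map_zero, add_zero] at hX
  induction g using induction_on with
  | add g h hg hh => rw [map_add, map_add, add_mul, mul_add, hg, hh]
  | monomial s i =>
    rw [map_mul, map_mul, map_pow, map_pow]
    have h1 : Commute (oreInclusion k B (e (C d s))) (fracEmb e f) := by
      rw [← fracEmb_algebraMap]
      exact (Commute.all _ _).map (fracEmb e)
    exact h1.mul_left (Commute.pow_left hX i)

/-- In characteristic zero and for `d ≠ 0`, a central fraction `z` is a fraction of elements of `S`
killed by `d`. The denominators of `z` form a two-sided ideal, so one of them lies in `S`, and the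
numerator then commutes with `S` and has degree zero. -/
theorem exists_fracEmb_eq_of_mem_center [CharZero k] (hd : d ≠ 0) {z : OreLocalization B⁰ B}
    (hz : z ∈ Subalgebra.center k (OreLocalization B⁰ B)) :
    ∃ f, fracDeriv d f = 0 ∧ fracEmb e f = z := by
  have : CharZero S := charZero_of_injective_algebraMap (algebraMap k S).injective
  rw [Subalgebra.mem_center_iff] at hz
  let ι : SkewPoly d →ₐ[k] OreLocalization B⁰ B := (oreInclusion k B).comp (e : SkewPoly d →ₐ[k] B)
  have hι : Function.Injective ι := (oreInclusion_injective k).comp e.injective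
  have hιC (s : S) : ι (C d s) = fracEmb e (algebraMap S (FractionRing S) s) :=
    (fracEmb_algebraMap e s).symm
  let I : TwoSidedIdeal (SkewPoly d) :=
    TwoSidedIdeal.mk' {u | ∃ w, ι u * z = ι w} ⟨0, by rw [map_zero, zero_mul]⟩
      (by rintro x y ⟨u, hu⟩ ⟨w, hw⟩; exact ⟨u + w, by rw [map_add, add_mul, hu, hw, map_add]⟩)
      (by rintro x ⟨u, hu⟩; exact ⟨-u, by rw [map_neg, neg_mul, hu, map_neg]⟩)
      (by rintro x y ⟨u, hu⟩; exact ⟨x * u, by rw [map_mul, mul_assoc, hu, map_mul]⟩)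
      (by
        rintro x y ⟨u, hu⟩
        exact ⟨u * y, by rw [map_mul, mul_assoc, hz, ← mul_assoc, hu, map_mul]⟩)
  obtain ⟨s, hs, hsI⟩ : ∃ s, s ≠ 0 ∧ C d s ∈ I := by
    obtain ⟨t, b, htb⟩ := exists_oreInclusion_mul_eq k z
    refine exists_C_mem hd I (f := e.symm t)
      ((TwoSidedIdeal.mem_mk' _ _ _ _ _ _ _).2 ⟨e.symm b, ?_⟩) ?_
    · simpa [ι] using htb
    · exact fun h =>
        nonZeroDivisors.coe_ne_zero t ((map_eq_zero_iff e.symm e.symm.injective).1 h)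
  obtain ⟨w, hw⟩ := (TwoSidedIdeal.mem_mk' _ _ _ _ _ _ _).1 hsI
  have hcomm (r : S) : w * C d r - C d r * w = 0 := by
    apply hι
    have h1 : C d s * C d r = C d r * C d s := by rw [← map_mul, ← map_mul, mul_comm]
    rw [map_sub, map_mul, map_mul, ← hw, map_zero, sub_eq_zero, mul_assoc, ← hz, ← mul_assoc,
      ← mul_assoc, ← map_mul ι, ← map_mul ι, h1]
  obtain ⟨t, rfl⟩ : ∃ t, w = C d t := by
    obtain ⟨r, hr⟩ : ∃ r, d r ≠ 0 := by
      by_contra! h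
      exact hd (Derivation.ext h)
    rcases hn : (toPoly d w).natDegree with _ | n
    · have h := eq_sum_C_mul_X_pow w
      rw [hn] at h
      exact ⟨_, by simpa using h⟩
    · have h1 := (coeff_commutator_C d w r hn.le).2
      rw [hcomm, map_zero, Polynomial.coeff_zero, eq_comm] at h1
      have h2 : (toPoly d w).coeff (n + 1) ≠ 0 := fun h0 => by
        rw [← hn, Polynomial.coeff_natDegree, Polynomial.leadingCoeff_eq_zero] at h0
        rw [h0, Polynomial.natDegree_zero] at hn
        lia
      exact absurd h1 (mul_ne_zero (mul_ne_zero (Nat.cast_ne_zero.2 n.succ_ne_zero) h2) hr)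
  have hs0 : algebraMap S (FractionRing S) s ≠ 0 := by simpa using hs
  refine ⟨algebraMap S (FractionRing S) t / algebraMap S (FractionRing S) s, ?_⟩
  have hf : fracEmb e (algebraMap S (FractionRing S) t / algebraMap S (FractionRing S) s) = z := by
    have hu : IsUnit (fracEmb e (algebraMap S (FractionRing S) s)) :=
      (IsUnit.mk0 _ hs0).map (fracEmb e)
    refine hu.mul_left_cancel ?_
    rw [← map_mul, mul_div_cancel₀ _ hs0, ← hιC, ← hιC, hw]
  refine ⟨(fracEmb e).toRingHom.injective ?_, hf⟩
  have h1 := X_mul_fracEmb e (algebraMap S (FractionRing S) t / algebraMap S (FractionRing S) s)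
  rw [hf, hz, left_eq_add] at h1
  exact h1.trans (map_zero _).symm

end Centre

section Rational

variable {k : Type u} {R : Type v} [Field k] [CommRing R] [Algebra k R] {δ : Derivation k R R}

/-- `R[x;δ] / P` is isomorphic to `(R/p)[x;δ]` if `P` is the extension of `p`. -/
noncomputable def quotientEquiv {p : Ideal R} (hp : IsPrimeDeltaIdeal δ p)
    {P : TwoSidedIdeal (SkewPoly δ)} (hP : P = extension hp) :
    SkewPoly (quotientDeriv δ p hp) ≃ₐ[k] SkewPoly δ ⧸ P.asIdeal :=
  ((Ideal.quotientEquivAlgOfEq k (show P.asIdeal = RingHom.ker (reduction hp) by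
    ext f; rw [TwoSidedIdeal.mem_asIdeal, hP, mem_extension_iff, RingHom.mem_ker])).trans
      (Ideal.quotientKerAlgEquivOfSurjective (reduction_surjective hp))).symm

theorem isRationalIdeal_iff [CharZero k] {P : TwoSidedIdeal (SkewPoly δ)}
    (hδ : ∃ r, C δ (δ r) ∉ P) (hp : IsPrimeDeltaIdeal δ (contraction P)) :
    P.IsRationalIdeal k ↔ IsDeltaRational δ (contraction P) hp := by
  have := hp.isPrime
  let e := quotientEquiv hp (eq_extension_contraction hp hδ)
  have : NoZeroDivisors (SkewPoly δ ⧸ P.asIdeal) := e.symm.injective.noZeroDivisors _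
    (map_zero _) (map_mul _)
  have : Nontrivial (SkewPoly δ ⧸ P.asIdeal) := e.injective.nontrivial
  have hd : quotientDeriv δ (contraction P) hp ≠ 0 := by
    obtain ⟨r, hr⟩ := hδ
    intro h
    have h1 := quotientDeriv_mk δ (contraction P) hp r
    rw [h, Derivation.zero_apply, eq_comm, Ideal.Quotient.eq_zero_iff_mem] at h1
    exact hr h1
  constructor
  · rintro ⟨_, -, halg⟩ f hf
    rw [← isAlgebraic_algHom_iff (fracEmb e) (fracEmb e).toRingHom.injective]
    have h1 := halg.isAlgebraic ⟨fracEmb e f, fracEmb_mem_center e hf⟩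
    exact h1.algHom (Subalgebra.val _)
  · intro h
    obtain ⟨hore⟩ := nonempty_oreSet e
    refine ⟨hore, isField_center_oreLocalization, ⟨fun z => ?_⟩⟩
    obtain ⟨f, hf, hfz⟩ := exists_fracEmb_eq_of_mem_center e hd z.2
    rw [← isAlgebraic_algHom_iff (Subalgebra.val _) Subtype.val_injective]
    rw [Subalgebra.coe_val, ← hfz]
    exact (h f hf).algHom (fracEmb e)

end Rational

end SkewPoly

/-! ### Prime ideals with a commutative affine quotient -/

section CommutativeQuotient

variable {k : Type u} {A : Type v} {B : Type*} [Field k] [Ring A] [Algebra k A] [CommRing B]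
  [Algebra k B] {P : TwoSidedIdeal A} (e : (A ⧸ P.asIdeal) ≃ₐ[k] B)

/-- The nonzero elements of `A / P` have left inverses. -/
def TwoSidedIdeal.HasInverses (P : TwoSidedIdeal A) : Prop :=
  ∀ a ∉ P, ∃ b, b * a - 1 ∈ P

/-- The homomorphism `A → B` induced by an isomorphism `A / P ≃ B`. -/
noncomputable def quotientHom : A →ₐ[k] B :=
  (e : (A ⧸ P.asIdeal) →ₐ[k] B).comp (Ideal.Quotient.mkₐ k P.asIdeal)

theorem quotientHom_surjective : Function.Surjective (quotientHom e) :=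
  e.surjective.comp (Ideal.Quotient.mkₐ_surjective k _)

theorem quotientHom_eq_zero_iff (a : A) : quotientHom e a = 0 ↔ a ∈ P := by
  change e (Ideal.Quotient.mk P.asIdeal a) = 0 ↔ a ∈ P
  rw [EmbeddingLike.map_eq_zero_iff, Ideal.Quotient.eq_zero_iff_mem, TwoSidedIdeal.mem_asIdeal]

include e in
theorem mul_sub_mul_mem (a b : A) : a * b - b * a ∈ P := by
  rw [← quotientHom_eq_zero_iff e, map_sub, map_mul, map_mul, mul_comm, sub_self]

include e in
/-- If `v` is an element of a simple module with annihilator `P` and `a v ≠ 0`, then `v = b a v` for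
some `b`, and the annihilator of `v` is two-sided modulo `P`, hence it is `P`. -/
theorem TwoSidedIdeal.IsPrimitiveIdeal.hasInverses (h : P.IsPrimitiveIdeal) : P.HasInverses := by
  obtain ⟨M, _, _, _, hann⟩ := h
  have hmem (a : A) : a ∈ P ↔ ∀ w : M, a • w = 0 := by
    rw [← TwoSidedIdeal.mem_asIdeal, hann, Module.mem_annihilator]
  intro a ha
  rw [hmem] at ha
  push Not at ha
  obtain ⟨v, hv⟩ := ha
  obtain ⟨b, hb⟩ := IsSimpleModule.toSpanSingleton_surjective A hv v
  rw [LinearMap.toSpanSingleton_apply, ← mul_smul] at hb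
  refine ⟨b, (hmem _).2 fun w => ?_⟩
  have hv0 : v ≠ 0 := by rintro rfl; exact hv (smul_zero a)
  obtain ⟨c, rfl⟩ := IsSimpleModule.toSpanSingleton_surjective A hv0 w
  have h1 := (hmem _).1 (mul_sub_mul_mem e (b * a) c) v
  rw [LinearMap.toSpanSingleton_apply, sub_smul, one_smul, ← mul_smul]
  rw [sub_smul, mul_smul c, hb] at h1
  exact h1

theorem TwoSidedIdeal.HasInverses.isPrimitiveIdeal (hP : P.IsPrimeIdeal) (h : P.HasInverses) :
    P.IsPrimitiveIdeal := by
  have hmax : P.asIdeal.IsMaximal := by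
    refine Ideal.isMaximal_iff.2 ⟨fun h1 => hP.1 (P.one_mem_iff.1 h1), fun J x hPJ hx hxJ => ?_⟩
    obtain ⟨b, hb⟩ := h x hx
    have h1 := J.sub_mem (J.mul_mem_left b hxJ) (hPJ (TwoSidedIdeal.mem_asIdeal.2 hb))
    rwa [sub_sub_cancel] at h1
  refine ⟨A ⧸ P.asIdeal, inferInstance, inferInstance, isSimpleModule_iff_isCoatom.2 hmax.1, ?_⟩
  ext a
  rw [TwoSidedIdeal.mem_asIdeal, Module.mem_annihilator]
  constructor
  · intro ha w
    obtain ⟨c, rfl⟩ := Submodule.Quotient.mk_surjective _ w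
    rw [← Submodule.Quotient.mk_smul, Submodule.Quotient.mk_eq_zero]
    exact P.mul_mem_right _ _ ha
  · intro ha
    have h1 := ha (Submodule.Quotient.mk 1)
    rwa [← Submodule.Quotient.mk_smul, Submodule.Quotient.mk_eq_zero, smul_eq_mul, mul_one] at h1

theorem TwoSidedIdeal.HasInverses.isLocallyClosedIdeal (hP : P.IsPrimeIdeal) (h : P.HasInverses) :
    P.IsLocallyClosedIdeal := by
  have hempty : {Q : TwoSidedIdeal A | Q.IsPrimeIdeal ∧ P < Q} = ∅ := by
    refine Set.eq_empty_of_forall_notMem fun Q ⟨hQ, hPQ⟩ => hQ.1 (Q.one_mem_iff.1 ?_)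
    obtain ⟨a, haQ, haP⟩ := SetLike.exists_of_lt hPQ
    obtain ⟨b, hb⟩ := h a haP
    have h1 := Q.sub_mem (Q.mul_mem_left b a haQ) (hPQ.le hb)
    rwa [sub_sub_cancel] at h1
  rw [IsLocallyClosedIdeal, hempty, sInf_empty]
  exact lt_top_iff_ne_top.2 hP.1

include e in
/-- If `P` is locally closed, a nonzero element of `B` lies in all nonzero maximal ideals; the
intersection of all maximal ideals being zero, the zero ideal is maximal. -/
theorem TwoSidedIdeal.IsLocallyClosedIdeal.hasInverses [IsDomain B] [IsJacobsonRing B]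
    (h : P.IsLocallyClosedIdeal) : P.HasInverses := by
  by_contra hinv
  obtain ⟨f, hf, hfP⟩ := SetLike.exists_of_lt h
  rw [TwoSidedIdeal.mem_sInf] at hf
  refine hfP ((quotientHom_eq_zero_iff e f).1 ?_)
  rw [← Ideal.mem_bot, ← IsJacobsonRing.out inferInstance (Ideal.isPrime_bot (α := B)).isRadical,
    Ideal.jacobson, Submodule.mem_sInf]
  rintro m ⟨-, hm⟩
  have hm0 : m ≠ ⊥ := by
    rintro rfl
    refine hinv fun a ha => ?_
    obtain ⟨y, i, hi, hy⟩ := hm.exists_inv (x := quotientHom e a)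
      fun h0 => ha ((quotientHom_eq_zero_iff e a).1 h0)
    obtain ⟨b, rfl⟩ := quotientHom_surjective e y
    refine ⟨b, (quotientHom_eq_zero_iff e _).1 ?_⟩
    rw [Ideal.mem_bot.1 hi, add_zero] at hy
    rw [map_sub, map_mul, hy, map_one, sub_self]
  have hQ (a : A) : a ∈ TwoSidedIdeal.comap (quotientHom e) (Ideal.toTwoSided m) ↔
      quotientHom e a ∈ m := by
    rw [TwoSidedIdeal.mem_comap, Ideal.mem_toTwoSided]
  refine (hQ f).1 (hf _ ⟨⟨fun htop => ?_, fun a b hab => ?_⟩, lt_of_le_of_ne ?_ fun heq => hm0 ?_⟩)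
  · have h1 : (1 : A) ∈ TwoSidedIdeal.comap (quotientHom e) (Ideal.toTwoSided m) := htop ▸ trivial
    rw [hQ, map_one] at h1
    exact hm.ne_top ((Ideal.eq_top_iff_one m).2 h1)
  · have h1 := hab 1
    simp only [hQ, mul_one, map_mul] at h1 ⊢
    exact hm.isPrime.mem_or_mem h1
  · intro a ha
    rw [hQ, (quotientHom_eq_zero_iff e a).2 ha]
    exact m.zero_mem
  · rw [eq_bot_iff]
    intro b hb
    obtain ⟨a, rfl⟩ := quotientHom_surjective e b
    rw [Ideal.mem_bot, quotientHom_eq_zero_iff, heq, hQ]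
    exact hb

include e in
theorem TwoSidedIdeal.IsRationalIdeal.hasInverses [IsDomain B] (h : P.IsRationalIdeal k) :
    P.HasInverses := by
  obtain ⟨_, -, halg⟩ := h
  intro a ha
  have hcen : oreInclusion k _ (Ideal.Quotient.mk P.asIdeal a) ∈ Subalgebra.center k
      (OreLocalization (A ⧸ P.asIdeal)⁰ (A ⧸ P.asIdeal)) := by
    refine mem_center_of_forall_commute fun b => ?_
    rw [← map_mul, ← map_mul]
    congr 1
    apply e.injective
    rw [map_mul, map_mul, mul_comm]
  have h1 : IsAlgebraic k (quotientHom e a) :=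
    ((isAlgebraic_algHom_iff _ (oreInclusion_injective k)).1
      ((halg.isAlgebraic ⟨_, hcen⟩).algHom (Subalgebra.val _))).algHom
        (e : (A ⧸ P.asIdeal) →ₐ[k] B)
  have h0 : quotientHom e a ≠ 0 := fun h0 => ha ((quotientHom_eq_zero_iff e a).1 h0)
  obtain ⟨y, hy⟩ := (h1.isIntegral.isUnit h0).exists_left_inv
  obtain ⟨b, rfl⟩ := quotientHom_surjective e y
  refine ⟨b, (quotientHom_eq_zero_iff e _).1 ?_⟩
  rw [map_sub, map_mul, hy, map_one, sub_self]

include e in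
/-- A field is its own ring of fractions, and it is algebraic over `k` if it is finitely generated as
a `k`-algebra, by Zariski's lemma. -/
theorem TwoSidedIdeal.HasInverses.isRationalIdeal [IsDomain B] [Algebra.FiniteType k B]
    (h : P.HasInverses) : P.IsRationalIdeal k := by
  have hinv (b : B) (hb : b ≠ 0) : ∃ c, b * c = 1 := by
    obtain ⟨a, rfl⟩ := quotientHom_surjective e b
    obtain ⟨c, hc⟩ := h a fun h0 => hb ((quotientHom_eq_zero_iff e a).2 h0)
    refine ⟨quotientHom e c, ?_⟩
    rw [← quotientHom_eq_zero_iff e, map_sub, map_mul, map_one, sub_eq_zero] at hc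
    rw [mul_comm, hc]
  have hfield : IsField B := ⟨exists_pair_ne B, mul_comm, fun {b} hb => hinv b hb⟩
  have halg : Algebra.IsAlgebraic k B := by
    let _ := hfield.toField
    have := finite_of_finite_type_of_isJacobsonRing k B
    infer_instance
  have : NoZeroDivisors (A ⧸ P.asIdeal) := e.injective.noZeroDivisors _ (map_zero _) (map_mul _)
  have : Nontrivial (A ⧸ P.asIdeal) := e.symm.injective.nontrivial
  obtain ⟨hore⟩ : Nonempty (OreLocalization.OreSet (A ⧸ P.asIdeal)⁰) := by
    rw [OreLocalization.nonempty_oreSet_iff_of_noZeroDivisors]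
    refine fun r s => ⟨r, s, e.injective ?_⟩
    rw [map_mul, map_mul, mul_comm]
  refine ⟨hore, isField_center_oreLocalization, ⟨fun z => ?_⟩⟩
  rw [← isAlgebraic_algHom_iff (Subalgebra.val _) Subtype.val_injective, Subalgebra.coe_val]
  obtain ⟨s, b, hz⟩ := exists_oreInclusion_mul_eq k
    (z : OreLocalization (A ⧸ P.asIdeal)⁰ (A ⧸ P.asIdeal))
  obtain ⟨c, hc⟩ := hinv (e s) fun h0 => nonZeroDivisors.coe_ne_zero s
    ((EmbeddingLike.map_eq_zero_iff (f := e)).1 h0)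
  have hcs : e.symm c * s = 1 := by
    apply e.injective
    rw [map_mul, AlgEquiv.apply_symm_apply, mul_comm, hc, map_one]
  have hzb : (z : OreLocalization (A ⧸ P.asIdeal)⁰ (A ⧸ P.asIdeal)) =
      oreInclusion k _ (e.symm c * b) := by
    rw [map_mul, ← hz, ← mul_assoc, ← map_mul, hcs, map_one, one_mul]
  rw [hzb]
  refine IsAlgebraic.algHom _ ((isAlgebraic_algHom_iff (e : (A ⧸ P.asIdeal) →ₐ[k] B)
    e.injective).1 (halg.isAlgebraic _))

end CommutativeQuotient

namespace SkewPoly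

section CommutativeQuotient

variable {k : Type u} {R : Type v} [Field k] [CommRing R] [Algebra k R] {δ : Derivation k R R}

/-- If `P` contains `δ(R)`, then `x` commutes with `R` modulo `P`, so `R[x;δ] / P` is a quotient of
the commutative polynomial ring over `R`. -/
theorem exists_commutative_quotient [Algebra.FiniteType k R] {P : TwoSidedIdeal (SkewPoly δ)}
    (hP : P.IsPrimeIdeal) (hδ : ∀ r, C δ (δ r) ∈ P) :
    ∃ (B : Type v) (_ : CommRing B) (_ : Algebra k B), IsDomain B ∧ Algebra.FiniteType k B ∧
      Nonempty ((SkewPoly δ ⧸ P.asIdeal) ≃ₐ[k] B) := by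
  let π : SkewPoly δ →ₐ[k] SkewPoly δ ⧸ P.asIdeal := Ideal.Quotient.mkₐ k P.asIdeal
  have hπ : Function.Surjective π := Ideal.Quotient.mkₐ_surjective k _
  have hπ0 (f : SkewPoly δ) : π f = 0 ↔ f ∈ P := by
    rw [← TwoSidedIdeal.mem_asIdeal]
    exact Ideal.Quotient.eq_zero_iff_mem
  have hCC (r s : R) : Commute (π (C δ r)) (π (C δ s)) :=
    ((Commute.all r s).map (C δ)).map π
  have hXC (r : R) : Commute (π (X δ)) (π (C δ r)) := by
    rw [Commute, SemiconjBy, ← map_mul, ← map_mul, X_mul_C, map_add, (hπ0 _).2 (hδ r), add_zero]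
  have hgen (b : SkewPoly δ ⧸ P.asIdeal) (hC : ∀ r, Commute b (π (C δ r)))
      (hX : Commute b (π (X δ))) (f : SkewPoly δ) : Commute b (π f) := by
    induction f using induction_on with
    | add f g hf hg => rw [map_add]; exact hf.add_right hg
    | monomial r i => rw [map_mul, map_pow]; exact (hC r).mul_right (hX.pow_right i)
  have hcomm (b c : SkewPoly δ ⧸ P.asIdeal) : b * c = c * b := by
    obtain ⟨f, rfl⟩ := hπ b
    obtain ⟨g, rfl⟩ := hπ c
    refine hgen _ (fun r => (hgen _ (hCC r) (hXC r).symm f).symm) ?_ g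
    exact (hgen _ hXC (Commute.refl _) f).symm
  let inst : CommRing (SkewPoly δ ⧸ P.asIdeal) :=
    { (inferInstance : Ring (SkewPoly δ ⧸ P.asIdeal)) with mul_comm := hcomm }
  refine ⟨SkewPoly δ ⧸ P.asIdeal, inst, inferInstanceAs (Algebra k (SkewPoly δ ⧸ P.asIdeal)),
    ?_, ?_, ⟨AlgEquiv.refl⟩⟩
  · have : Nontrivial (SkewPoly δ ⧸ P.asIdeal) :=
      ⟨⟨π 1, 0, fun h => hP.1 (P.one_mem_iff.1 ((hπ0 1).1 h))⟩⟩
    have : NoZeroDivisors (SkewPoly δ ⧸ P.asIdeal) := ⟨fun {b c} hbc => by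
      obtain ⟨f, rfl⟩ := hπ b
      obtain ⟨g, rfl⟩ := hπ c
      rw [hπ0, hπ0]
      refine hP.2 f g fun h => ?_
      rw [← hπ0, map_mul, map_mul, hcomm (π f), mul_assoc]
      exact (congrArg (π h * ·) hbc).trans (mul_zero _)⟩
    exact NoZeroDivisors.to_isDomain _
  · let φ : Polynomial R →ₐ[k] SkewPoly δ ⧸ P.asIdeal :=
      { Polynomial.eval₂RingHom ((π : SkewPoly δ →+* SkewPoly δ ⧸ P.asIdeal).comp (C δ))
          (π (X δ)) with
        commutes' := fun c => by
          have h1 : algebraMap k (Polynomial R) c = Polynomial.C (algebraMap k R c) := rfl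
          simp only [RingHom.toMonoidHom_eq_coe, OneHom.toFun_eq_coe, MonoidHom.toOneHom_coe,
            MonoidHom.coe_coe, h1, Polynomial.coe_eval₂RingHom, Polynomial.eval₂_C]
          exact π.commutes c }
    refine Algebra.FiniteType.of_surjective φ fun b => ?_
    obtain ⟨f, rfl⟩ := hπ b
    refine ⟨toPoly δ f, ?_⟩
    change Polynomial.eval₂ ((π : SkewPoly δ →+* SkewPoly δ ⧸ P.asIdeal).comp (C δ)) (π (X δ))
      (toPoly δ f) = π f
    induction f using induction_on with
    | add f g hf hg => rw [map_add, map_add, Polynomial.eval₂_add, hf, hg]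
    | monomial r i =>
      rw [toPoly_C_mul_X_pow, Polynomial.eval₂_monomial, map_mul, map_pow]
      rfl

end CommutativeQuotient

end SkewPoly

theorem proposition4p8 {k : Type u} [Field k] [CharZero k]
    {R : Type v} [CommRing R] [IsDomain R] [Algebra k R] [Algebra.FiniteType k R]
    (δ : Derivation k R R) :
    ((∀ (P : Ideal R) (hP : IsPrimeDeltaIdeal δ P),
        IsDeltaRational δ P hP → IsDeltaLocallyClosed δ P) →
      ∀ P : TwoSidedIdeal (SkewPoly δ),
        P.IsPrimeIdeal → P.IsRationalIdeal k → P.IsLocallyClosedIdeal) ∧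
    (SatisfiesDeltaDME δ → SatisfiesDME k (SkewPoly δ)) := by
  have : IsNoetherianRing R := Algebra.FiniteType.isNoetherianRing k R
  have : IsJacobsonRing R := isJacobsonRing_of_finiteType (A := k)
  constructor
  · intro h P hP hrat
    by_cases hδ : ∀ r, SkewPoly.C δ (δ r) ∈ P
    · obtain ⟨B, _, _, _, _, ⟨e⟩⟩ := SkewPoly.exists_commutative_quotient hP hδ
      exact (hrat.hasInverses e).isLocallyClosedIdeal hP
    · push Not at hδ
      have hp := SkewPoly.isPrimeDeltaIdeal_contraction hP
      exact (SkewPoly.isLocallyClosedIdeal_iff hP hδ).2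
        (h _ hp ((SkewPoly.isRationalIdeal_iff hδ hp).1 hrat))
  · intro h P hP
    by_cases hδ : ∀ r, SkewPoly.C δ (δ r) ∈ P
    · obtain ⟨B, _, _, _, _, ⟨e⟩⟩ := SkewPoly.exists_commutative_quotient hP hδ
      have : IsJacobsonRing B := isJacobsonRing_of_finiteType (A := k)
      exact ⟨⟨fun hprim => (hprim.hasInverses e).isLocallyClosedIdeal hP,
          fun hlc => (hlc.hasInverses e).isPrimitiveIdeal hP⟩,
        ⟨fun hlc => (hlc.hasInverses e).isRationalIdeal e,
          fun hrat => (hrat.hasInverses e).isLocallyClosedIdeal hP⟩⟩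
    · push Not at hδ
      have hp := SkewPoly.isPrimeDeltaIdeal_contraction hP
      obtain ⟨h1, h2⟩ := h _ hp
      rw [SkewPoly.isLocallyClosedIdeal_iff hP hδ, SkewPoly.isRationalIdeal_iff hδ hp]
      refine ⟨⟨fun hprim => h1.1 (SkewPoly.isDeltaPrimitive_of_isPrimitiveIdeal hP hprim),
        fun hlc => SkewPoly.isPrimitiveIdeal_of_isDeltaPrimitive hP hδ (h1.2 hlc)⟩, h2⟩
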